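/- Let $n\ge 1$ and $d\ge 0$ be integers. A polynomial $f\in\mathbb{R}[w_1,\dots,w_n]$ is called real stable if $f(z)\neq 0$ for all $z\in\mathbb{C}^n$ with $\operatorname{Im}(z_j)>0$ for every $j$. Let $\mathbb{P}\mathrm{S}^d_n$ be the set of all real stable polynomials $f\in\mathbb{R}[w_1,\dots,w_n]$ that are homogeneous of degree $d$, have nonnegative coefficients, and satisfy $f(1,\dots,1)=1$, equipped with the subspace topology inherited from the finite-dimensional Euclidean space of coefficients of homogeneous polynomials of degree $d$. Then $\mathbb{P}\mathrm{S}^d_n$ is homeomorphic to a closed Euclidean ball, i.e. to $\{x\in\mathbb{R}^m : \|x\|\le 1\}$ for some integer $m\ge 0$. -/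

import Mathlib

/-- The real vector space `H_n^d` of homogeneous polynomials of degree `d` in `n` real variables,
together with the zero polynomial. -/
abbrev HomPoly (n d : ℕ) : Type :=
  ↥(MvPolynomial.homogeneousSubmodule (Fin n) ℝ d)

/-- The vector of coefficients of a form of degree `d`, indexed by the exponents of degree `d`. -/
def HomPoly.coeffs {n d : ℕ} (f : HomPoly n d) : {α : Fin n →₀ ℕ // α.degree = d} → ℝ :=
  fun α => MvPolynomial.coeff α.1 f.1

/-- The standard Euclidean topology on the (finite-dimensional) space of coefficients. -/
instance HomPoly.instTopologicalSpace (n d : ℕ) : TopologicalSpace (HomPoly n d) :=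
  TopologicalSpace.induced HomPoly.coeffs inferInstance

/-- A real polynomial is real stable if it has no zero all of whose coordinates lie in the open
upper half-plane. -/
def IsRealStable {n : ℕ} (f : MvPolynomial (Fin n) ℝ) : Prop :=
  ∀ z : Fin n → ℂ, (∀ j, 0 < (z j).im) → MvPolynomial.aeval z f ≠ 0

/-- The set `S_n^d` of real stable forms of degree `d` in `n` variables with nonnegative
coefficients. -/
def stableForms (n d : ℕ) : Set (HomPoly n d) :=
  {f | IsRealStable f.1 ∧ ∀ α, 0 ≤ MvPolynomial.coeff α f.1}

/-- The set `PS_n^d` of all `f` in `S_n^d` with `f(1, …, 1) = 1`. It carries the subspace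
topology. -/
def projStableForms (n d : ℕ) : Set (HomPoly n d) :=
  {f | f ∈ stableForms n d ∧ MvPolynomial.eval (fun _ => (1 : ℝ)) f.1 = 1}

section

open Set Metric Pointwise

/-! ### Strictly star-shaped compact sets are balls -/

section Star

variable {E : Type*} [NormedAddCommGroup E] [NormedSpace ℝ E] {K : Set E}

/-! A linear flow contracts the affine space of normalized forms to a point and pushes the set of
stable forms into its own interior at every positive time. A compact nonempty set with such a flow
is a ball: powers of the coordinates turn the diagonal flow into scaling, and the gauge then
compares the set radially with the unit ball (`nonempty_homeomorph_closedBall_of_flow`).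

In degree `k + 1` the generator is `A = R ∂`, where `∂ = ∑ ∂ᵢ` and `R = ∑ (D wᵢ - wᵢ² ∂ᵢ)` with `D =
k + 1`; `∂` and `R` are lowering and raising operators, adjoint for the inner product weighted by
binomial coefficients. So `A` is self-adjoint and has an eigenbasis. Its top eigenvalue is
`exclusionRate`, attained at a form with positive coefficients, and a minimum principle makes all
eigenvalues on forms vanishing at `(1, …, 1)` strictly smaller (`eq_zero_of_exclusionOp_eq`). After
normalization the flow of `A` therefore contracts.

Stability is preserved because each Euler step `f + s A f` is stable: on the upper half-space `f /
∂f` has positive imaginary part and `R ∂f / ∂f` has nonnegative imaginary part. Products of Euler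
steps converge to the flow, and stability of normalized nonnegative forms is a closed condition.

The flow enters the interior for two reasons. A coefficient that vanished at a positive time would
be at a minimum in time, which forces all coefficients to vanish (`hasPosCoeffs_flow`). A multiple
real zero would likewise put the Laguerre expression at its minimum `0`, while its time derivative
is positive (`eval_diagDeriv_flow_ne_zero`). With positive coefficients and simple real zeros, a
compactness argument on zeros of nearby unstable forms rules out instability (`flow_mem_interior`).
-/

theorem gauge_le_iff_of_strictStar (hK : IsClosed K) (h0 : K ∈ nhds (0 : E))
    (hs : ∀ r : ℝ, 0 ≤ r → r < 1 → ∀ x ∈ K, r • x ∈ interior K) {a : ℝ} (ha : 0 < a) (x : E) :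
    gauge K x ≤ a ↔ a⁻¹ • x ∈ K := by
  have habs : Absorbent ℝ K := absorbent_nhds_zero h0
  constructor
  · intro h
    -- The infimum in the gauge need not be attained a priori, so the point is first shrunk by `r <
    -- 1`; closedness of `K` then allows `r → 1`.
    have key : ∀ r ∈ Ioo (0 : ℝ) 1, r • (a⁻¹ • x) ∈ K := by
      rintro r ⟨hr0, hr1⟩
      have hlt : gauge K x < a / r := lt_of_le_of_lt h (by rw [lt_div_iff₀ hr0]; nlinarith)
      obtain ⟨b, hb0, hb, y, hy, rfl⟩ := exists_lt_of_gauge_lt habs hlt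
      have : r • (a⁻¹ • (b • y)) = (r * a⁻¹ * b) • y := by simp [smul_smul, mul_assoc]
      show r • (a⁻¹ • (b • y)) ∈ K
      rw [this]
      refine interior_subset (hs _ (by positivity) ?_ y hy)
      rw [lt_div_iff₀ hr0] at hb
      rw [mul_right_comm, ← div_eq_mul_inv, div_lt_one ha]
      linarith
    have ht : Filter.Tendsto (fun r : ℝ => r • (a⁻¹ • x)) (nhdsWithin 1 (Iio 1))
        (nhds ((1 : ℝ) • (a⁻¹ • x))) :=
      ((continuous_id.smul continuous_const).tendsto (1 : ℝ)).mono_left nhdsWithin_le_nhds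
    rw [one_smul] at ht
    exact hK.mem_of_tendsto ht (Filter.mem_of_superset (Ioo_mem_nhdsLT one_pos) key)
  · intro h
    exact gauge_le_of_mem ha.le ((mem_smul_set_iff_inv_smul_mem₀ ha.ne' _ _).2 h)

theorem gauge_lt_iff_of_strictStar (h0 : K ∈ nhds (0 : E))
    (hs : ∀ r : ℝ, 0 ≤ r → r < 1 → ∀ x ∈ K, r • x ∈ interior K) {a : ℝ} (ha : 0 < a) (x : E) :
    gauge K x < a ↔ a⁻¹ • x ∈ interior K := by
  have habs : Absorbent ℝ K := absorbent_nhds_zero h0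
  constructor
  · intro h
    obtain ⟨b, hb0, hb, y, hy, rfl⟩ := exists_lt_of_gauge_lt habs h
    show a⁻¹ • (b • y) ∈ interior K
    rw [smul_smul]
    refine hs _ (by positivity) ?_ y hy
    rw [mul_comm, ← div_eq_mul_inv, div_lt_one ha]
    exact hb
  · intro h
    have := interior_subset_gauge_lt_one K h
    rw [mem_ofPred, gauge_smul_of_nonneg (inv_nonneg.2 ha.le), smul_eq_mul, mul_comm,
      ← div_eq_mul_inv, div_lt_one ha] at this
    exact this

theorem gauge_pos_of_isCompact (hK : IsCompact K) (h0 : K ∈ nhds (0 : E)) {x : E} (hx : x ≠ 0) :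
    0 < gauge K x :=
  (gauge_pos (absorbent_nhds_zero h0)
    ((NormedSpace.isVonNBounded_iff ℝ).2 hK.isBounded)).2 hx

/-- For `a > 0`, sublevel sets are dilates of the closed set `K` and strict sublevel sets are
dilates of its interior. No convexity is available, so strict star-shapedness replaces it.
Compactness settles the level `0`, where the sublevel set is a single point. -/
theorem continuous_gauge_of_strictStar (hK : IsCompact K) (h0 : K ∈ nhds (0 : E))
    (hs : ∀ r : ℝ, 0 ≤ r → r < 1 → ∀ x ∈ K, r • x ∈ interior K) : Continuous (gauge K) := by
  refine (OrderTopology.continuous_iff).2 fun a => ⟨?_, ?_⟩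
  · have h : gauge K ⁻¹' Ioi a = (gauge K ⁻¹' Iic a)ᶜ := by ext; simp
    rw [h, isOpen_compl_iff]
    rcases lt_trichotomy a 0 with ha | rfl | ha
    · have : gauge K ⁻¹' Iic a = ∅ := by
        ext x
        simpa using ha.trans_le (gauge_nonneg x)
      rw [this]; exact isClosed_empty
    · have : gauge K ⁻¹' Iic 0 = {0} := by
        ext x
        simp only [mem_preimage, mem_Iic, mem_singleton_iff]
        refine ⟨fun h => ?_, fun h => by simp [h]⟩
        by_contra hx
        exact absurd (gauge_pos_of_isCompact hK h0 hx) (not_lt.2 h)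
      rw [this]; exact isClosed_singleton
    · have : gauge K ⁻¹' Iic a = (fun x => a⁻¹ • x) ⁻¹' K := by
        ext x
        exact gauge_le_iff_of_strictStar hK.isClosed h0 hs ha x
      rw [this]
      exact hK.isClosed.preimage (continuous_const_smul _)
  · rcases le_or_gt a 0 with ha | ha
    · have : gauge K ⁻¹' Iio a = ∅ := by
        ext x
        simpa using ha.trans (gauge_nonneg x)
      rw [this]; exact isOpen_empty
    · have : gauge K ⁻¹' Iio a = (fun x => a⁻¹ • x) ⁻¹' interior K := by
        ext x
        exact gauge_lt_iff_of_strictStar h0 hs ha x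
      rw [this]
      exact isOpen_interior.preimage (continuous_const_smul _)

/-- The radial map carrying the gauge of `K` to the norm. -/
noncomputable def radialToBall (K : Set E) (x : E) : E := (gauge K x / ‖x‖) • x

/-- The radial map carrying the norm to the gauge of `K`. -/
noncomputable def radialFromBall (K : Set E) (y : E) : E := (‖y‖ / gauge K y) • y

theorem norm_radialToBall (K : Set E) (x : E) : ‖radialToBall K x‖ = gauge K x := by
  rcases eq_or_ne x 0 with rfl | hx
  · simp [radialToBall]
  · rw [radialToBall, norm_smul, Real.norm_of_nonneg (div_nonneg (gauge_nonneg _) (norm_nonneg _)),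
      div_mul_cancel₀ _ (norm_ne_zero_iff.2 hx)]

theorem gauge_radialFromBall (hK : IsCompact K) (h0 : K ∈ nhds (0 : E)) (y : E) :
    gauge K (radialFromBall K y) = ‖y‖ := by
  rcases eq_or_ne y 0 with rfl | hy
  · simp [radialFromBall]
  · rw [radialFromBall, gauge_smul_of_nonneg (div_nonneg (norm_nonneg _) (gauge_nonneg _)),
      smul_eq_mul, div_mul_cancel₀ _ (gauge_pos_of_isCompact hK h0 hy).ne']

theorem radialFromBall_radialToBall (hK : IsCompact K) (h0 : K ∈ nhds (0 : E)) (x : E) :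
    radialFromBall K (radialToBall K x) = x := by
  rcases eq_or_ne x 0 with rfl | hx
  · simp [radialFromBall, radialToBall]
  · have hg := (gauge_pos_of_isCompact hK h0 hx).ne'
    have hn := norm_ne_zero_iff.2 hx
    rw [radialFromBall, norm_radialToBall, radialToBall,
      gauge_smul_of_nonneg (div_nonneg (gauge_nonneg _) (norm_nonneg _)), smul_smul, smul_eq_mul]
    convert one_smul ℝ x using 2
    field_simp

theorem radialToBall_radialFromBall (hK : IsCompact K) (h0 : K ∈ nhds (0 : E)) (y : E) :
    radialToBall K (radialFromBall K y) = y := by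
  rcases eq_or_ne y 0 with rfl | hy
  · simp [radialFromBall, radialToBall]
  · have hg := (gauge_pos_of_isCompact hK h0 hy).ne'
    have hn := norm_ne_zero_iff.2 hy
    rw [radialToBall, gauge_radialFromBall hK h0, radialFromBall, norm_smul,
      Real.norm_of_nonneg (div_nonneg (norm_nonneg _) (gauge_nonneg _)), smul_smul]
    convert one_smul ℝ y using 2
    field_simp

theorem continuous_radialToBall (hK : IsCompact K) (h0 : K ∈ nhds (0 : E))
    (hs : ∀ r : ℝ, 0 ≤ r → r < 1 → ∀ x ∈ K, r • x ∈ interior K) :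
    Continuous (radialToBall K) := by
  have hg := continuous_gauge_of_strictStar hK h0 hs
  refine continuous_iff_continuousAt.2 fun x => ?_
  rcases eq_or_ne x 0 with rfl | hx
  · have h : radialToBall K 0 = 0 := by simp [radialToBall]
    rw [ContinuousAt, h, tendsto_zero_iff_norm_tendsto_zero]
    simp_rw [norm_radialToBall]
    simpa using hg.tendsto 0
  · exact ((hg.continuousAt).div continuous_norm.continuousAt (norm_ne_zero_iff.2 hx)).smul
      continuousAt_id

/-- A nonempty compact set that is mapped into its interior by every scaling `r ∈ [0, 1)` is
homeomorphic to the closed unit ball. -/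
theorem nonempty_homeomorph_closedBall_of_strictStar (hK : IsCompact K) (hne : K.Nonempty)
    (hs : ∀ r : ℝ, 0 ≤ r → r < 1 → ∀ x ∈ K, r • x ∈ interior K) :
    Nonempty (K ≃ₜ closedBall (0 : E) 1) := by
  have h0 : K ∈ nhds (0 : E) := by
    obtain ⟨x, hx⟩ := hne
    have := hs 0 le_rfl one_pos x hx
    rw [zero_smul] at this
    exact mem_interior_iff_mem_nhds.1 this
  have hmem : ∀ x, x ∈ K ↔ gauge K x ≤ 1 := fun x => by
    simpa using (gauge_le_iff_of_strictStar hK.isClosed h0 hs one_pos x).symm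
  have := isCompact_iff_compactSpace.1 hK
  let e : K ≃ closedBall (0 : E) 1 :=
    { toFun := fun x => ⟨radialToBall K x, by
        rw [mem_closedBall_zero_iff, norm_radialToBall]; exact (hmem x).1 x.2⟩
      invFun := fun y => ⟨radialFromBall K y, by
        rw [hmem, gauge_radialFromBall hK h0]; exact mem_closedBall_zero_iff.1 y.2⟩
      left_inv := fun x => Subtype.ext (radialFromBall_radialToBall hK h0 _)
      right_inv := fun y => Subtype.ext (radialToBall_radialFromBall hK h0 _) }
  exact ⟨Continuous.homeoOfEquivCompactToT2 (f := e)
    (((continuous_radialToBall hK h0 hs).comp continuous_subtype_val).subtype_mk _)⟩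

end Star

/-! ### Straightening a contracting diagonal flow into scaling -/

section Flow

/-- The odd extension of `x ↦ x ^ p` from the positive reals. -/
noncomputable def oddRpow (p x : ℝ) : ℝ := max x 0 ^ p - max (-x) 0 ^ p

theorem oddRpow_of_nonneg {p x : ℝ} (hp : 0 < p) (hx : 0 ≤ x) : oddRpow p x = x ^ p := by
  simp [oddRpow, hx, Real.zero_rpow hp.ne']

theorem oddRpow_of_nonpos {p x : ℝ} (hp : 0 < p) (hx : x ≤ 0) : oddRpow p x = -(-x) ^ p := by
  simp [oddRpow, hx, Real.zero_rpow hp.ne']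

theorem continuous_oddRpow {p : ℝ} (hp : 0 < p) : Continuous (oddRpow p) :=
  ((continuous_id.max continuous_const).rpow_const fun _ => Or.inr hp.le).sub
    ((continuous_neg.max continuous_const).rpow_const fun _ => Or.inr hp.le)

theorem oddRpow_oddRpow_inv {p : ℝ} (hp : 0 < p) (x : ℝ) : oddRpow p⁻¹ (oddRpow p x) = x := by
  rcases le_total 0 x with hx | hx
  · rw [oddRpow_of_nonneg hp hx, oddRpow_of_nonneg (inv_pos.2 hp) (Real.rpow_nonneg hx _),
      Real.rpow_rpow_inv hx hp.ne']
  · have h : 0 ≤ -x := by linarith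
    rw [oddRpow_of_nonpos hp hx, oddRpow_of_nonpos (inv_pos.2 hp)
      (neg_nonpos.2 (Real.rpow_nonneg h _)), neg_neg, Real.rpow_rpow_inv h hp.ne', neg_neg]

theorem oddRpow_mul {p r : ℝ} (hp : 0 < p) (hr : 0 ≤ r) (x : ℝ) :
    oddRpow p (r * x) = r ^ p * oddRpow p x := by
  rcases le_total 0 x with hx | hx
  · rw [oddRpow_of_nonneg hp hx, oddRpow_of_nonneg hp (mul_nonneg hr hx), Real.mul_rpow hr hx]
  · rw [oddRpow_of_nonpos hp hx, oddRpow_of_nonpos hp (mul_nonpos_of_nonneg_of_nonpos hr hx),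
      ← mul_neg, Real.mul_rpow hr (by linarith)]
    ring

/-- `oddRpow p` as a homeomorphism of the line. -/
noncomputable def oddRpowHomeomorph {p : ℝ} (hp : 0 < p) : ℝ ≃ₜ ℝ where
  toFun := oddRpow p
  invFun := oddRpow p⁻¹
  left_inv := oddRpow_oddRpow_inv hp
  right_inv x := by simpa using oddRpow_oddRpow_inv (inv_pos.2 hp) x
  continuous_toFun := continuous_oddRpow hp
  continuous_invFun := continuous_oddRpow (inv_pos.2 hp)

/-- A nonempty compact set that a contracting diagonal linear flow maps into its interior in every
positive time is homeomorphic to a closed ball. -/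
theorem nonempty_homeomorph_closedBall_of_flow {m : ℕ} (lam : Fin m → ℝ) (hlam : ∀ i, 0 < lam i)
    {K : Set (Fin m → ℝ)} (hK : IsCompact K) (hne : K.Nonempty)
    (hs : ∀ t : ℝ, 0 < t → ∀ x ∈ K, (fun i => Real.exp (-(lam i * t)) * x i) ∈ interior K) :
    Nonempty (K ≃ₜ closedBall (0 : EuclideanSpace ℝ (Fin m)) 1) := by
  -- Raising the `i`-th coordinate to the power `1 / lam i` turns the factor `exp (-(lam i * t))`
  -- into `exp (-t)`, the same for all `i`. Scaling by `r` is thus the flow at time `-log r`.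
  let Φ : (Fin m → ℝ) ≃ₜ EuclideanSpace ℝ (Fin m) :=
    (Homeomorph.piCongrRight fun i => oddRpowHomeomorph (inv_pos.2 (hlam i))).trans
      (EuclideanSpace.equiv (Fin m) ℝ).symm.toHomeomorph
  have hΦ : ∀ x i, Φ x i = oddRpow (lam i)⁻¹ (x i) := fun x i => rfl
  have hpos : ∀ r : ℝ, 0 < r → r < 1 → ∀ x ∈ Φ '' K, r • x ∈ interior (Φ '' K) := by
    rintro r hr0 hr1 _ ⟨x, hx, rfl⟩
    rw [← Φ.image_interior]
    refine ⟨_, hs (-Real.log r) (by simpa using Real.log_neg hr0 hr1) x hx, ?_⟩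
    ext i
    rw [hΦ, PiLp.smul_apply, hΦ, oddRpow_mul (inv_pos.2 (hlam i)) (Real.exp_pos _).le, smul_eq_mul,
      ← Real.exp_mul]
    have : -(lam i * -Real.log r) * (lam i)⁻¹ = Real.log r := by
      field_simp [(hlam i).ne']
    rw [this, Real.exp_log hr0]
  have hcK : IsCompact (Φ '' K) := hK.image Φ.continuous
  have hstar : ∀ r : ℝ, 0 ≤ r → r < 1 → ∀ x ∈ Φ '' K, r • x ∈ interior (Φ '' K) := by
    intro r hr0 hr1 x hx
    rcases hr0.eq_or_lt with rfl | hr0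
    -- The factor `r = 0` corresponds to infinite time. The origin is in the compact image as a
    -- limit of scalings, and being fixed by the factor `1 / 2` it is an interior point.
    · have h0 : (0 : EuclideanSpace ℝ (Fin m)) ∈ Φ '' K := by
        have ht : Filter.Tendsto (fun r : ℝ => r • x) (nhdsWithin 0 (Ioi 0))
            (nhds ((0 : ℝ) • x)) :=
          ((continuous_id.smul continuous_const).tendsto (0 : ℝ)).mono_left nhdsWithin_le_nhds
        rw [zero_smul] at ht
        refine hcK.isClosed.mem_of_tendsto ht
          (Filter.mem_of_superset (Ioo_mem_nhdsGT one_pos) fun r hr => ?_)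
        exact interior_subset (s := Φ '' K) (hpos r hr.1 hr.2 x hx)
      have := hpos (1 / 2) (by norm_num) (by norm_num) 0 h0
      rw [smul_zero] at this
      rwa [zero_smul]
    · exact hpos r hr0 hr1 x hx
  obtain ⟨e⟩ := nonempty_homeomorph_closedBall_of_strictStar hcK (hne.image _) hstar
  exact ⟨(Φ.image K).trans e⟩

end Flow

end

section

open MvPolynomial

/-! ### Restriction of a polynomial to a complex line -/

section Line

variable {n : ℕ}

/-- The univariate polynomial `t ↦ f (z + t v)`. -/
noncomputable def lineRestrict (f : MvPolynomial (Fin n) ℝ) (z v : Fin n → ℂ) : Polynomial ℂ :=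
  aeval (fun i => Polynomial.C (z i) + Polynomial.C (v i) * Polynomial.X) f

theorem eval_lineRestrict (f : MvPolynomial (Fin n) ℝ) (z v : Fin n → ℂ) (t : ℂ) :
    (lineRestrict f z v).eval t = aeval (fun i => z i + v i * t) f := by
  unfold lineRestrict
  induction f using MvPolynomial.induction_on with
  | C a => simp [Polynomial.algebraMap_apply]
  | add p q hp hq => simp [hp, hq]
  | mul_X p i hp => simp [hp]

theorem eval_zero_lineRestrict (f : MvPolynomial (Fin n) ℝ) (z v : Fin n → ℂ) :
    (lineRestrict f z v).eval 0 = aeval z f := by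
  simp [eval_lineRestrict]

theorem derivative_lineRestrict (f : MvPolynomial (Fin n) ℝ) (z v : Fin n → ℂ) :
    Polynomial.derivative (lineRestrict f z v) =
      ∑ i, Polynomial.C (v i) * lineRestrict (pderiv i f) z v := by
  unfold lineRestrict
  induction f using MvPolynomial.induction_on with
  | C a => simp [Polynomial.algebraMap_apply]
  | add p q hp hq => simp [hp, hq, mul_add, Finset.sum_add_distrib]
  | mul_X p i hp =>
    have hX : ∀ j, aeval (fun i => Polynomial.C (z i) + Polynomial.C (v i) * Polynomial.X)
        (pderiv j (X i : MvPolynomial (Fin n) ℝ)) = if i = j then (1 : Polynomial ℂ) else 0 := by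
      intro j
      rw [pderiv_X, Pi.single_apply]
      split_ifs <;> simp_all
    simp only [map_mul, aeval_X, Polynomial.derivative_mul, hp, Derivation.leibniz,
      smul_eq_mul, map_add, mul_add, Finset.sum_add_distrib, hX, Polynomial.derivative_C,
      Polynomial.derivative_X, mul_ite, mul_zero, mul_one, zero_mul, zero_add, Finset.sum_ite_eq,
      Finset.mem_univ, if_true]
    have h : ∀ q : Fin n → Polynomial ℂ,
        ∑ j, Polynomial.C (v j) *
          ((Polynomial.C (z i) + Polynomial.C (v i) * Polynomial.X) * q j) =
        (Polynomial.C (z i) + Polynomial.C (v i) * Polynomial.X) *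
          ∑ j, Polynomial.C (v j) * q j := by
      intro q
      rw [Finset.mul_sum]
      exact Finset.sum_congr rfl fun j _ => by ring
    rw [h]
    ring

theorem lineRestrict_eq_sum (f : MvPolynomial (Fin n) ℝ) (z v : Fin n → ℂ) :
    lineRestrict f z v = ∑ α ∈ f.support, Polynomial.C ((coeff α f : ℝ) : ℂ) *
      ∏ i, (Polynomial.C (z i) + Polynomial.C (v i) * Polynomial.X) ^ α i := by
  unfold lineRestrict
  rw [aeval_def, eval₂_eq']
  simp [Polynomial.algebraMap_apply]

theorem natDegree_linear_pow_le (a b : ℂ) (k : ℕ) :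
    ((Polynomial.C a + Polynomial.C b * Polynomial.X) ^ k).natDegree ≤ k := by
  refine Polynomial.natDegree_pow_le.trans ?_
  have : (Polynomial.C a + Polynomial.C b * Polynomial.X).natDegree ≤ 1 := by compute_degree
  nlinarith

theorem natDegree_prod_linear_pow_le (z v : Fin n → ℂ) (α : Fin n →₀ ℕ) :
    (∏ i, (Polynomial.C (z i) + Polynomial.C (v i) * Polynomial.X) ^ α i).natDegree
      ≤ α.degree := by
  refine (Polynomial.natDegree_prod_le _ _).trans ?_
  rw [Finsupp.degree_eq_sum]
  exact Finset.sum_le_sum fun i _ => natDegree_linear_pow_le _ _ _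

theorem coeff_linear_pow (a b : ℂ) (k : ℕ) :
    ((Polynomial.C a + Polynomial.C b * Polynomial.X) ^ k).coeff k = b ^ k := by
  have := Polynomial.coeff_pow_of_natDegree_le
    (p := Polynomial.C a + Polynomial.C b * Polynomial.X) (m := k) (n := 1)
    (by compute_degree)
  simpa using this

theorem coeff_prod_linear_pow (z v : Fin n → ℂ) (α : Fin n →₀ ℕ) (s : Finset (Fin n)) :
    (∏ i ∈ s, (Polynomial.C (z i) + Polynomial.C (v i) * Polynomial.X) ^ α i).coeff
      (∑ i ∈ s, α i) = ∏ i ∈ s, v i ^ α i := by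
  induction s using Finset.induction_on with
  | empty => simp
  | insert i s hi ih =>
    rw [Finset.prod_insert hi, Finset.sum_insert hi, Finset.prod_insert hi,
      Polynomial.coeff_mul_add_eq_of_natDegree_le (natDegree_linear_pow_le _ _ _), ih, coeff_linear_pow]
    exact (Polynomial.natDegree_prod_le _ _).trans
      (Finset.sum_le_sum fun i _ => natDegree_linear_pow_le _ _ _)

theorem natDegree_lineRestrict_le {f : MvPolynomial (Fin n) ℝ} {d : ℕ} (hf : f.IsHomogeneous d)
    (z v : Fin n → ℂ) : (lineRestrict f z v).natDegree ≤ d := by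
  rw [lineRestrict_eq_sum]
  refine Polynomial.natDegree_sum_le_of_forall_le _ _ fun α hα => ?_
  refine (Polynomial.natDegree_C_mul_le _ _).trans ((natDegree_prod_linear_pow_le z v α).trans ?_)
  by_contra h
  exact (mem_support_iff.1 hα) (hf.coeff_eq_zero (by omega))

/-- Each monomial contributes `∏ i, v i ^ α i` in top degree. Hence when `f` does not vanish at `v`,
the restriction has full degree `d` and its leading coefficient is known. -/
theorem coeff_lineRestrict {f : MvPolynomial (Fin n) ℝ} {d : ℕ} (hf : f.IsHomogeneous d)
    (z v : Fin n → ℂ) : (lineRestrict f z v).coeff d = aeval v f := by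
  rw [lineRestrict_eq_sum, Polynomial.finsetSum_coeff, aeval_def, eval₂_eq']
  refine Finset.sum_congr rfl fun α hα => ?_
  have : α.degree = d := by
    by_contra h
    exact (mem_support_iff.1 hα) (hf.coeff_eq_zero h)
  rw [Polynomial.coeff_C_mul, ← this, Finsupp.degree_eq_sum, coeff_prod_linear_pow]
  rfl

theorem natDegree_lineRestrict {f : MvPolynomial (Fin n) ℝ} {d : ℕ} (hf : f.IsHomogeneous d)
    (z v : Fin n → ℂ) (hv : aeval v f ≠ 0) : (lineRestrict f z v).natDegree = d :=
  le_antisymm (natDegree_lineRestrict_le hf z v)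
    (Polynomial.le_natDegree_of_ne_zero (by rwa [coeff_lineRestrict hf]))

/-- The derivative `∑ i, v i ∂ᵢ` in the direction `v`. -/
noncomputable def dirDeriv (v : Fin n → ℝ) :
    MvPolynomial (Fin n) ℝ →ₗ[ℝ] MvPolynomial (Fin n) ℝ :=
  ∑ i, v i • (pderiv i).toLinearMap

theorem dirDeriv_apply (v : Fin n → ℝ) (f : MvPolynomial (Fin n) ℝ) :
    dirDeriv v f = ∑ i, v i • pderiv i f := by
  simp [dirDeriv]

theorem dirDeriv_isHomogeneous {f : MvPolynomial (Fin n) ℝ} {d : ℕ} (v : Fin n → ℝ)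
    (hf : f.IsHomogeneous (d + 1)) : (dirDeriv v f).IsHomogeneous d := by
  rw [dirDeriv_apply]
  refine IsHomogeneous.sum _ _ _ fun i _ => ?_
  rw [smul_eq_C_mul]
  exact (hf.pderiv (i := i)).C_mul _

theorem eval_derivative_lineRestrict (f : MvPolynomial (Fin n) ℝ) (z : Fin n → ℂ)
    (v : Fin n → ℝ) (t : ℂ) :
    (Polynomial.derivative (lineRestrict f z (fun i => (v i : ℂ)))).eval t =
      aeval (fun i => z i + v i * t) (dirDeriv v f) := by
  rw [derivative_lineRestrict, dirDeriv_apply, Polynomial.eval_finsetSum, map_sum]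
  refine Finset.sum_congr rfl fun i _ => ?_
  rw [Polynomial.eval_mul, Polynomial.eval_C, eval_lineRestrict, map_smul, Complex.real_smul]

theorem aeval_ofReal (f : MvPolynomial (Fin n) ℝ) (x : Fin n → ℝ) :
    aeval (fun i => (x i : ℂ)) f = ((eval x f : ℝ) : ℂ) := by
  induction f using MvPolynomial.induction_on with
  | C a => simp
  | add p q hp hq => simp [hp, hq]
  | mul_X p i hp => simp [hp]

end Line

end

section

open MvPolynomial

/-! ### Univariate estimates -/

section Univariate

theorem Multiset.im_sum_nonpos (s : Multiset ℂ) (h : ∀ a ∈ s, a.im ≤ 0) : s.sum.im ≤ 0 := by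
  induction s using Multiset.induction_on with
  | empty => simp
  | cons a s ih =>
    rw [Multiset.sum_cons, Complex.add_im]
    have h1 := h a (Multiset.mem_cons_self a s)
    have h2 := ih fun b hb => h b (Multiset.mem_cons_of_mem hb)
    linarith

theorem Multiset.im_sum_neg {s : Multiset ℂ} (hs : s ≠ 0) (h : ∀ a ∈ s, a.im < 0) :
    s.sum.im < 0 := by
  obtain ⟨a, ha⟩ := Multiset.exists_mem_of_ne_zero hs
  obtain ⟨t, rfl⟩ := Multiset.exists_cons_of_mem ha
  rw [Multiset.sum_cons, Complex.add_im]
  have h1 := h a (Multiset.mem_cons_self a t)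
  have h2 := Multiset.im_sum_nonpos t fun b hb => (h b (Multiset.mem_cons_of_mem hb)).le
  linarith

theorem Multiset.one_le_norm_prod (s : Multiset ℂ) (h : ∀ a ∈ s, 1 ≤ ‖a‖) : 1 ≤ ‖s.prod‖ := by
  induction s using Multiset.induction_on with
  | empty => simp
  | cons a s ih =>
    rw [Multiset.prod_cons, norm_mul]
    exact one_le_mul_of_one_le_of_one_le (h a (Multiset.mem_cons_self a s))
      (ih fun b hb => h b (Multiset.mem_cons_of_mem hb))

theorem Complex.im_one_div_neg_of_im_neg {r : ℂ} (hr : r.im < 0) : (1 / (0 - r)).im < 0 := by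
  rw [one_div, Complex.inv_im, zero_sub, Complex.neg_im, neg_neg]
  refine div_neg_of_neg_of_pos hr (Complex.normSq_pos.2 fun h => ?_)
  rw [neg_eq_zero] at h
  simp [h] at hr

/-- The Gauss–Lucas argument: `p' / p` at `0` is the sum of `1 / (0 - r)` over the roots, and each
term lies in the open lower half-plane. The degree condition supplies at least one root. -/
theorem Polynomial.im_logDeriv_neg {p : Polynomial ℂ} (h0 : p.eval 0 ≠ 0)
    (hdeg : p.natDegree ≠ 0) (h : ∀ r, p.eval r = 0 → r.im < 0) :
    (p.derivative.eval 0 / p.eval 0).im < 0 := by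
  have hp : p.Splits := IsAlgClosed.splits p
  rw [hp.eval_derivative_div_eval_of_ne_zero h0]
  refine Multiset.im_sum_neg ?_ ?_
  · rw [Ne, Multiset.map_eq_zero, ← Multiset.card_eq_zero]
    rwa [← hp.natDegree_eq_card_roots]
  · intro a ha
    obtain ⟨r, hr, rfl⟩ := Multiset.mem_map.1 ha
    exact Complex.im_one_div_neg_of_im_neg (h r (Polynomial.isRoot_of_mem_roots hr))

theorem Polynomial.im_logDeriv_nonpos {p : Polynomial ℂ} (h0 : p.eval 0 ≠ 0)
    (h : ∀ r, p.eval r = 0 → r.im < 0) :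
    (p.derivative.eval 0 / p.eval 0).im ≤ 0 := by
  by_cases hdeg : p.natDegree = 0
  · rw [Polynomial.eq_C_of_natDegree_eq_zero hdeg]
    simp
  · exact (Polynomial.im_logDeriv_neg h0 hdeg h).le

/-- With `ρ = w + r` the expression is `w ρ / (ρ - w)`, which for `ρ ≠ 0` is the reciprocal of `1 /
w - 1 / ρ`. Inversion exchanges the half-planes, so that difference lies in the lower one and its
reciprocal in the upper one. -/
theorem Complex.im_sub_sq_div_nonneg {w r : ℂ} (hw : 0 < w.im) (hr : (w + r).im ≤ 0) :
    0 ≤ (w - w ^ 2 * (1 / (0 - r))).im := by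
  have hr0 : r ≠ 0 := by
    rintro rfl
    simp at hr
    linarith
  have hns : 0 < Complex.normSq r := Complex.normSq_pos.2 hr0
  have : w - w ^ 2 * (1 / (0 - r)) = w * (w + r) * (starRingEnd ℂ) r / (Complex.normSq r : ℂ) := by
    have : (Complex.normSq r : ℂ) = r * (starRingEnd ℂ) r := (Complex.mul_conj r).symm
    have hc : (starRingEnd ℂ) r ≠ 0 := (map_ne_zero _).2 hr0
    rw [this]
    field_simp
    ring
  rw [this, Complex.div_ofReal_im]
  refine div_nonneg ?_ hns.le
  simp only [Complex.mul_im, Complex.mul_re, Complex.conj_re, Complex.conj_im, Complex.add_re,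
    Complex.add_im] at *
  nlinarith [mul_nonneg hw.le (sq_nonneg (w.re + r.re)), mul_nonneg hw.le (sq_nonneg (w.im + r.im)),
    mul_nonneg (neg_nonneg.2 hr) (sq_nonneg w.re), mul_nonneg (neg_nonneg.2 hr) (sq_nonneg w.im)]

/-- A form of Laguerre's theorem on polar derivatives. The expression is a sum over `D` roots: each
actual root contributes as in `Complex.im_sub_sq_div_nonneg`, and each of the `D - p.natDegree`
roots at infinity contributes `w`. The variable is centred at `w`, so a root `r` represents the
point `w + r`. -/
theorem Polynomial.im_polar_nonneg {p : Polynomial ℂ} {D : ℕ} (h0 : p.eval 0 ≠ 0)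
    (hdeg : p.natDegree ≤ D) {w : ℂ} (hw : 0 < w.im) (h : ∀ r, p.eval r = 0 → (w + r).im ≤ 0) :
    0 ≤ (D * w - w ^ 2 * (p.derivative.eval 0 / p.eval 0)).im := by
  have hp : p.Splits := IsAlgClosed.splits p
  rw [hp.eval_derivative_div_eval_of_ne_zero h0]
  have hcard := hp.natDegree_eq_card_roots
  have hroots : ∀ r ∈ p.roots, (w + r).im ≤ 0 :=
    fun r hr => h r (Polynomial.isRoot_of_mem_roots hr)
  have key : ∀ s : Multiset ℂ, (∀ r ∈ s, (w + r).im ≤ 0) →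
      0 ≤ ((Multiset.card s : ℂ) * w - w ^ 2 * (s.map fun z => 1 / (0 - z)).sum).im := by
    intro s
    induction s using Multiset.induction_on with
    | empty => simp
    | cons a s ih =>
      intro hs
      have h1 := Complex.im_sub_sq_div_nonneg hw (hs a (Multiset.mem_cons_self a s))
      have h2 := ih fun b hb => hs b (Multiset.mem_cons_of_mem hb)
      have : ((Multiset.card (a ::ₘ s) : ℂ) * w -
          w ^ 2 * ((a ::ₘ s).map fun z => 1 / (0 - z)).sum) =
          (w - w ^ 2 * (1 / (0 - a))) +
          ((Multiset.card s : ℂ) * w - w ^ 2 * (s.map fun z => 1 / (0 - z)).sum) := by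
        rw [Multiset.card_cons, Multiset.map_cons, Multiset.sum_cons]
        push_cast
        ring
      rw [this, Complex.add_im]
      linarith
  have h1 := key p.roots hroots
  rw [← hcard] at h1
  have h2 : ((D : ℂ) * w).im = D * w.im := by simp [Complex.mul_im]
  have h3 : ((p.natDegree : ℂ) * w).im = p.natDegree * w.im := by simp [Complex.mul_im]
  have h4 : (p.natDegree : ℝ) ≤ D := by exact_mod_cast hdeg
  rw [Complex.sub_im, h3] at h1
  rw [Complex.sub_im, h2]
  nlinarith

end Univariate

/-! ### Stable forms -/

section Stable

variable {n : ℕ}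

/-- Real stable forms of degree `d` with nonnegative coefficients. -/
structure IsStableForm (d : ℕ) (f : MvPolynomial (Fin n) ℝ) : Prop where
  homogeneous : f.IsHomogeneous d
  stable : IsRealStable f
  coeff_nonneg : ∀ α, 0 ≤ coeff α f

theorem eval_pos_of_coeff_nonneg {f : MvPolynomial (Fin n) ℝ} (hf : ∀ α, 0 ≤ coeff α f)
    (h0 : f ≠ 0) {y : Fin n → ℝ} (hy : ∀ i, 0 < y i) : 0 < eval y f := by
  rw [eval_eq']
  refine Finset.sum_pos (fun α hα => mul_pos ((hf α).lt_of_ne' (mem_support_iff.1 hα))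
    (Finset.prod_pos fun i _ => pow_pos (hy i) _)) ?_
  exact support_nonempty.2 h0

theorem IsRealStable.ne_zero {f : MvPolynomial (Fin n) ℝ} (hf : IsRealStable f) : f ≠ 0 := by
  rintro rfl
  exact hf (fun _ => Complex.I) (by simp) (map_zero _)

theorem continuous_aeval_complex (f : MvPolynomial (Fin n) ℝ) :
    Continuous fun z : Fin n → ℂ => aeval z f := by
  induction f using MvPolynomial.induction_on with
  | C a => simpa using continuous_const
  | add p q hp hq => simpa using! hp.add hq
  | mul_X p i hp => simpa using! hp.mul (continuous_apply i)

theorem IsRealStable.im_root_neg {f : MvPolynomial (Fin n) ℝ} (hf : IsRealStable f)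
    {z : Fin n → ℂ} (hz : ∀ j, 0 < (z j).im) {v : Fin n → ℝ} (hv : ∀ j, 0 ≤ v j) {t : ℂ}
    (ht : (lineRestrict f z fun i => (v i : ℂ)).eval t = 0) : t.im < 0 := by
  by_contra h
  rw [eval_lineRestrict] at ht
  refine hf _ (fun j => ?_) ht
  rw [Complex.add_im, Complex.im_ofReal_mul] 
  have := mul_nonneg (hv j) (not_lt.1 h)
  linarith [hz j]

theorem IsRealStable.im_dirDeriv_div_nonpos {f : MvPolynomial (Fin n) ℝ} (hf : IsRealStable f)
    {z : Fin n → ℂ} (hz : ∀ j, 0 < (z j).im) {v : Fin n → ℝ} (hv : ∀ j, 0 ≤ v j) :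
    (aeval z (dirDeriv v f) / aeval z f).im ≤ 0 := by
  have h := Polynomial.im_logDeriv_nonpos (p := lineRestrict f z fun i => (v i : ℂ))
    (by rw [eval_zero_lineRestrict]; exact hf z hz) fun r hr => hf.im_root_neg hz hv hr
  simpa [eval_derivative_lineRestrict, eval_zero_lineRestrict] using h

/-- Strictness needs a nonconstant restriction to the line. Its leading coefficient is `f` evaluated
at the positive vector `v`, which is positive, and its degree is `d + 1`. -/
theorem IsStableForm.im_dirDeriv_div_neg {d : ℕ} {f : MvPolynomial (Fin n) ℝ}
    (hf : IsStableForm (d + 1) f) {z : Fin n → ℂ} (hz : ∀ j, 0 < (z j).im) {v : Fin n → ℝ}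
    (hv : ∀ j, 0 < v j) :
    (aeval z (dirDeriv v f) / aeval z f).im < 0 := by
  have hdeg : (lineRestrict f z fun i => (v i : ℂ)).natDegree = d + 1 := by
    refine natDegree_lineRestrict hf.homogeneous _ _ ?_
    rw [aeval_ofReal, Complex.ofReal_ne_zero]
    exact (eval_pos_of_coeff_nonneg hf.coeff_nonneg hf.stable.ne_zero hv).ne'
  have h := Polynomial.im_logDeriv_neg (p := lineRestrict f z fun i => (v i : ℂ))
    (by rw [eval_zero_lineRestrict]; exact hf.stable z hz) (by omega)
    fun r hr => hf.stable.im_root_neg hz (fun j => (hv j).le) hr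
  simpa [eval_derivative_lineRestrict, eval_zero_lineRestrict] using h

theorem coeff_dirDeriv (v : Fin n → ℝ) (f : MvPolynomial (Fin n) ℝ) (α : Fin n →₀ ℕ) :
    coeff α (dirDeriv v f) = ∑ i, v i * (coeff (α + Finsupp.single i 1) f * (α i + 1)) := by
  rw [dirDeriv_apply, coeff_sum]
  simp [coeff_pderiv]

theorem IsStableForm.isStableForm_dirDeriv {d : ℕ} {f : MvPolynomial (Fin n) ℝ}
    (hf : IsStableForm (d + 1) f) {v : Fin n → ℝ} (hv : ∀ j, 0 < v j) :
    IsStableForm d (dirDeriv v f) where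
  homogeneous := dirDeriv_isHomogeneous v hf.homogeneous
  stable := fun z hz h0 => by
    have := hf.im_dirDeriv_div_neg hz hv
    simp [h0] at this
  coeff_nonneg := fun α => by
    rw [coeff_dirDeriv]
    exact Finset.sum_nonneg fun i _ => mul_nonneg (hv i).le
      (mul_nonneg (hf.coeff_nonneg _) (by positivity))

/-! ### The raising operator and stability of Euler steps -/

/-- The raising operator `h ↦ ∑ i, (D wᵢ - wᵢ² ∂ᵢ) h`. -/
noncomputable def raiseOp (D : ℕ) : MvPolynomial (Fin n) ℝ →ₗ[ℝ] MvPolynomial (Fin n) ℝ :=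
  ∑ i, ((D : ℝ) • LinearMap.mulLeft ℝ (X i) -
    (LinearMap.mulLeft ℝ (X i ^ 2)).comp (pderiv i).toLinearMap)

theorem raiseOp_apply (D : ℕ) (h : MvPolynomial (Fin n) ℝ) :
    raiseOp D h = ∑ i, ((D : ℝ) • (X i * h) - X i ^ 2 * pderiv i h) := by
  simp [raiseOp]

theorem dirDeriv_single (i : Fin n) (f : MvPolynomial (Fin n) ℝ) :
    dirDeriv (Pi.single i 1) f = pderiv i f := by
  rw [dirDeriv_apply, Finset.sum_eq_single i] <;> simp +contextual

theorem aeval_raiseOp (D : ℕ) (h : MvPolynomial (Fin n) ℝ) (z : Fin n → ℂ) :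
    aeval z (raiseOp D h) =
      ∑ i, (D * z i * aeval z h - z i ^ 2 * aeval z (pderiv i h)) := by
  rw [raiseOp_apply, map_sum]
  refine Finset.sum_congr rfl fun i _ => ?_
  simp [mul_assoc]

theorem IsRealStable.im_raiseOp_div_nonneg {d D : ℕ} {h : MvPolynomial (Fin n) ℝ}
    (hh : IsRealStable h) (hd : h.IsHomogeneous d) (hD : d ≤ D) {z : Fin n → ℂ}
    (hz : ∀ j, 0 < (z j).im) : 0 ≤ (aeval z (raiseOp D h) / aeval z h).im := by
  have h0 := hh z hz
  rw [aeval_raiseOp, Finset.sum_div, Complex.im_sum]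
  refine Finset.sum_nonneg fun i _ => ?_
  -- Only the `i`-th variable moves; a root `r` with `z i + r` in the upper half-plane would be a
  -- zero of `h` in the upper half-space.
  have key := Polynomial.im_polar_nonneg (w := z i)
    (p := lineRestrict h z fun j => ((Pi.single i 1 : Fin n → ℝ) j : ℂ)) (D := D)
    (by rwa [eval_zero_lineRestrict]) ((natDegree_lineRestrict_le hd _ _).trans hD) (hz i) ?_
  · rw [eval_derivative_lineRestrict, eval_zero_lineRestrict, dirDeriv_single] at key
    simp only [mul_zero, add_zero] at key
    have heq : (D * z i * aeval z h - z i ^ 2 * aeval z (pderiv i h)) / aeval z h =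
        D * z i - z i ^ 2 * (aeval z (pderiv i h) / aeval z h) := by
      rw [sub_div, mul_div_cancel_right₀ _ h0, mul_div_assoc]
    rwa [heq]
  · intro r hr
    by_contra hlt
    rw [eval_lineRestrict] at hr
    refine hh _ (fun j => ?_) hr
    rcases eq_or_ne j i with rfl | hj
    · simpa using hlt
    · simpa [hj] using hz j

/-- Divide by `∂f`: the first summand becomes `f / ∂f`, with positive imaginary part, and the second
has nonnegative imaginary part, so the sum cannot vanish. -/
theorem IsStableForm.isRealStable_add_raiseOp {d D : ℕ} {f : MvPolynomial (Fin n) ℝ}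
    (hf : IsStableForm (d + 1) f) (hD : d ≤ D) {s : ℝ} (hs : 0 ≤ s) :
    IsRealStable (f + s • raiseOp D (dirDeriv (fun _ => 1) f)) := by
  intro z hz h
  have hg := hf.isStableForm_dirDeriv (v := fun _ => 1) fun _ => one_pos
  have h1 := hf.im_dirDeriv_div_neg hz (v := fun _ => 1) fun _ => one_pos
  have h2 := hg.stable.im_raiseOp_div_nonneg hg.homogeneous hD hz
  have ha := hf.stable z hz
  have hb := hg.stable z hz
  rw [map_add, map_smul, Complex.real_smul] at h
  set a := aeval z f
  set b := aeval z (dirDeriv (fun _ => 1) f)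
  set c := aeval z (raiseOp D (dirDeriv (fun _ => 1) f))
  have h3 : 0 < (a / b).im := by
    rw [← inv_div, Complex.inv_im]
    exact div_pos (neg_pos.2 h1) (Complex.normSq_pos.2 (div_ne_zero hb ha))
  have h4 : a / b + s * (c / b) = 0 := by
    rw [← mul_div_assoc, ← add_div, h, zero_div]
  have h5 := congrArg Complex.im h4
  rw [Complex.add_im, Complex.im_ofReal_mul, Complex.zero_im] at h5
  nlinarith [mul_nonneg hs h2]

end Stable

end

section

open MvPolynomial

/-! ### Inequalities on the boundary of the upper half-space -/

section Boundary

variable {n : ℕ}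

/-- A stable form satisfies `f y ≤ |f (x + i y)|` for positive `y`. -/
theorem IsRealStable.eval_le_norm {d : ℕ} {f : MvPolynomial (Fin n) ℝ} (hf : IsRealStable f)
    (hd : f.IsHomogeneous d) (x : Fin n → ℝ) {y : Fin n → ℝ} (hy : ∀ j, 0 < y j) :
    eval y f ≤ ‖aeval (fun j => (x j : ℂ) + y j * Complex.I) f‖ := by
  rcases eq_or_ne (eval y f) 0 with h0 | h0
  · rw [h0]; exact norm_nonneg _
  have hlead : aeval (fun j => (y j : ℂ)) f ≠ 0 := by
    rwa [aeval_ofReal, Complex.ofReal_ne_zero]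
  have hdeg := natDegree_lineRestrict hd (fun j => (x j : ℂ)) _ hlead
  have hp : (lineRestrict f (fun j => (x j : ℂ)) fun j => (y j : ℂ)).Splits :=
    IsAlgClosed.splits _
  -- The value at `t = i` is `f y` times the product of `i - r` over the roots; each root has
  -- nonpositive imaginary part, so each factor has norm at least `1`.
  rw [← eval_lineRestrict f (fun j => (x j : ℂ)) (fun j => (y j : ℂ)), hp.eval_eq_prod_roots,
    Polynomial.leadingCoeff, hdeg, coeff_lineRestrict hd, aeval_ofReal, norm_mul, Complex.norm_real]
  refine (le_abs_self _).trans (le_mul_of_one_le_right (abs_nonneg _) ?_)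
  refine Multiset.one_le_norm_prod _ fun a ha => ?_
  obtain ⟨r, hr, rfl⟩ := Multiset.mem_map.1 ha
  have hr := Polynomial.isRoot_of_mem_roots hr
  rw [Polynomial.IsRoot, eval_lineRestrict] at hr
  have him : r.im ≤ 0 := by
    by_contra hpos
    refine hf _ (fun j => ?_) hr
    rw [Complex.add_im, Complex.ofReal_im, Complex.im_ofReal_mul, zero_add]
    exact mul_pos (hy j) (not_le.1 hpos)
  have h1 : (1 : ℝ) ≤ (Complex.I - r).im := by
    rw [Complex.sub_im, Complex.I_im]; linarith
  exact h1.trans ((le_abs_self _).trans (Complex.abs_im_le_norm _))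

theorem tendsto_add_small (x : Fin n → ℝ) :
    Filter.Tendsto (fun ε : ℝ => fun j => x j + ε) (nhdsWithin 0 (Set.Ioi 0)) (nhds x) := by
  have h : Continuous fun ε : ℝ => fun j => x j + ε := by fun_prop
  have h2 := h.tendsto (0 : ℝ)
  simp only [add_zero] at h2
  exact h2.mono_left nhdsWithin_le_nhds

theorem IsRealStable.eval_le_norm_of_nonneg {d : ℕ} {f : MvPolynomial (Fin n) ℝ}
    (hf : IsRealStable f) (hd : f.IsHomogeneous d) (x : Fin n → ℝ) {y : Fin n → ℝ}
    (hy : ∀ j, 0 ≤ y j) :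
    eval y f ≤ ‖aeval (fun j => (x j : ℂ) + y j * Complex.I) f‖ := by
  have hc : Continuous fun y : Fin n → ℝ => fun j => (x j : ℂ) + y j * Complex.I := by fun_prop
  refine le_of_tendsto_of_tendsto
    (((MvPolynomial.continuous_eval f).tendsto y).comp (tendsto_add_small y))
    ((((continuous_aeval_complex f).comp hc).norm.tendsto y).comp (tendsto_add_small y)) ?_
  filter_upwards [self_mem_nhdsWithin] with ε hε
  exact hf.eval_le_norm hd x fun j => add_pos_of_nonneg_of_pos (hy j) hε

/-- Multiplying the quotient by `|f z|²` removes the denominator, so the inequality passes to the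
closed half-space, including zeros of `f`. -/
theorem IsRealStable.im_dirDeriv_mul_conj_nonpos {f : MvPolynomial (Fin n) ℝ}
    (hf : IsRealStable f) {z : Fin n → ℂ} (hz : ∀ j, 0 ≤ (z j).im) {v : Fin n → ℝ}
    (hv : ∀ j, 0 ≤ v j) :
    (aeval z (dirDeriv v f) * (starRingEnd ℂ) (aeval z f)).im ≤ 0 := by
  have hpos : ∀ z : Fin n → ℂ, (∀ j, 0 < (z j).im) →
      (aeval z (dirDeriv v f) * (starRingEnd ℂ) (aeval z f)).im ≤ 0 := by
    intro z hz
    have h := hf.im_dirDeriv_div_nonpos hz hv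
    have h0 := hf z hz
    have : aeval z (dirDeriv v f) * (starRingEnd ℂ) (aeval z f) =
        aeval z (dirDeriv v f) / aeval z f * (Complex.normSq (aeval z f) : ℂ) := by
      rw [← Complex.mul_conj, div_mul_eq_mul_div]
      field_simp
    rw [this, Complex.im_mul_ofReal]
    exact mul_nonpos_of_nonpos_of_nonneg h (Complex.normSq_nonneg _)
  have hc : Continuous fun ε : ℝ => fun j => z j + ε * Complex.I := by fun_prop
  have hc2 : Continuous fun z : Fin n → ℂ =>
      (aeval z (dirDeriv v f) * (starRingEnd ℂ) (aeval z f)).im :=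
    Complex.continuous_im.comp ((continuous_aeval_complex _).mul
      (Complex.continuous_conj.comp (continuous_aeval_complex _)))
  have ht := ((hc2.comp hc).tendsto (0 : ℝ)).mono_left (nhdsWithin_le_nhds (s := Set.Ioi 0))
  simp only [Function.comp_def, Complex.ofReal_zero, zero_mul, add_zero] at ht
  refine le_of_tendsto ht ?_
  filter_upwards [self_mem_nhdsWithin] with ε hε
  refine hpos _ fun j => ?_
  rw [Complex.add_im, Complex.im_ofReal_mul, Complex.I_im, mul_one]
  exact add_pos_of_nonneg_of_pos (hz j) hε

/-! ### Real lines: Laguerre's inequality and the order of real zeros -/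

/-- The real univariate polynomial `t ↦ f (x + t v)`. -/
noncomputable def realLine (f : MvPolynomial (Fin n) ℝ) (x v : Fin n → ℝ) : Polynomial ℝ :=
  aeval (fun i => Polynomial.C (x i) + Polynomial.C (v i) * Polynomial.X) f

theorem aeval_realLine (f : MvPolynomial (Fin n) ℝ) (x v : Fin n → ℝ) (t : ℂ) :
    Polynomial.aeval t (realLine f x v) = aeval (fun i => (x i : ℂ) + v i * t) f := by
  unfold realLine
  induction f using MvPolynomial.induction_on with
  | C a => simp
  | add p q hp hq => simp [hp, hq]
  | mul_X p i hp => simp [hp]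

theorem eval_realLine (f : MvPolynomial (Fin n) ℝ) (x v : Fin n → ℝ) (t : ℝ) :
    (realLine f x v).eval t = eval (fun i => x i + v i * t) f := by
  unfold realLine
  induction f using MvPolynomial.induction_on with
  | C a => simp
  | add p q hp hq => simp [hp, hq]
  | mul_X p i hp => simp [hp]

theorem eval_zero_realLine (f : MvPolynomial (Fin n) ℝ) (x v : Fin n → ℝ) :
    (realLine f x v).eval 0 = eval x f := by
  simp [eval_realLine]

theorem derivative_realLine (f : MvPolynomial (Fin n) ℝ) (x v : Fin n → ℝ) :
    Polynomial.derivative (realLine f x v) = realLine (dirDeriv v f) x v := by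
  have hinj : Function.Injective (Polynomial.map (algebraMap ℝ ℂ)) :=
    Polynomial.map_injective _ (algebraMap ℝ ℂ).injective
  have h : ∀ g : MvPolynomial (Fin n) ℝ, Polynomial.map (algebraMap ℝ ℂ) (realLine g x v) =
      lineRestrict g (fun i => (x i : ℂ)) fun i => (v i : ℂ) := fun g => by
    refine Polynomial.funext fun t => ?_
    rw [eval_lineRestrict, ← aeval_realLine, Polynomial.eval_map_algebraMap]
  refine hinj ?_
  rw [← Polynomial.derivative_map, h]
  refine Polynomial.funext fun t => ?_
  rw [eval_derivative_lineRestrict, Polynomial.eval_map_algebraMap, aeval_realLine]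

/-- Laguerre's inequality for real stable polynomials. -/
theorem IsRealStable.mul_dirDeriv_dirDeriv_le {f : MvPolynomial (Fin n) ℝ} (hf : IsRealStable f)
    {v : Fin n → ℝ} (hv : ∀ j, 0 ≤ v j) (x : Fin n → ℝ) :
    eval x f * eval x (dirDeriv v (dirDeriv v f)) ≤ eval x (dirDeriv v f) ^ 2 := by
  set p := realLine f x v with hp
  set q := p.divX with hq
  set r := (Polynomial.derivative p).divX with hr
  have hpq : p = Polynomial.X * q + Polynomial.C (eval x f) := by
    rw [hq]
    conv_lhs => rw [← Polynomial.X_mul_divX_add p]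
    rw [Polynomial.coeff_zero_eq_eval_zero, hp, eval_zero_realLine]
  have hpr : Polynomial.derivative p =
      Polynomial.X * r + Polynomial.C (eval x (dirDeriv v f)) := by
    rw [hr]
    conv_lhs => rw [← Polynomial.X_mul_divX_add (Polynomial.derivative p)]
    rw [Polynomial.coeff_zero_eq_eval_zero, hp, derivative_realLine, eval_zero_realLine]
  have hq0 : q.eval 0 = eval x (dirDeriv v f) := by
    have := congrArg (fun s => (Polynomial.derivative s).eval 0) hpq
    simp only [Polynomial.derivative_add, Polynomial.derivative_mul, Polynomial.derivative_X,
      Polynomial.derivative_C, Polynomial.eval_add, Polynomial.eval_mul, Polynomial.eval_X,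
      one_mul, zero_mul, add_zero] at this
    rw [← this, hp, derivative_realLine, eval_zero_realLine]
  have hr0 : r.eval 0 = eval x (dirDeriv v (dirDeriv v f)) := by
    have := congrArg (fun s => (Polynomial.derivative s).eval 0) hpr
    simp only [Polynomial.derivative_add, Polynomial.derivative_mul, Polynomial.derivative_X,
      Polynomial.derivative_C, Polynomial.eval_add, Polynomial.eval_mul, Polynomial.eval_X,
      one_mul, zero_mul, add_zero] at this
    rw [← this, hp, derivative_realLine, derivative_realLine, eval_zero_realLine]
  set a := eval x f
  set b := eval x (dirDeriv v f)
  let Q : ℝ → ℂ := fun τ => Polynomial.aeval ((τ : ℂ) * Complex.I) q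
  let R : ℝ → ℂ := fun τ => Polynomial.aeval ((τ : ℂ) * Complex.I) r
  have hcQ : Continuous Q := by
    show Continuous fun τ : ℝ => Polynomial.aeval ((τ : ℂ) * Complex.I) q
    fun_prop
  have hcR : Continuous R := by
    show Continuous fun τ : ℝ => Polynomial.aeval ((τ : ℂ) * Complex.I) r
    fun_prop
  have hQ0 : Q 0 = (b : ℂ) := by
    simp only [Q, Complex.ofReal_zero, zero_mul]
    rw [← hq0, ← Complex.coe_algebraMap, ← Polynomial.aeval_algebraMap_apply_eq_algebraMap_eval]
    simp
  have hR0 : R 0 = (eval x (dirDeriv v (dirDeriv v f)) : ℂ) := by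
    simp only [R, Complex.ofReal_zero, zero_mul]
    rw [← hr0, ← Complex.coe_algebraMap, ← Polynomial.aeval_algebraMap_apply_eq_algebraMap_eval]
    simp
  -- At `t = iτ` one has `p = a + iτ Q` and `p' = b + iτ R`. The imaginary part of `p'` times the
  -- conjugate of `p` is divisible by `τ`; dividing and letting `τ → 0` leaves the second-order
  -- inequality.
  have key : ∀ τ : ℝ, 0 < τ →
      a * (R τ).re - b * (Q τ).re + τ * (R τ * (starRingEnd ℂ) (Q τ)).im ≤ 0 := by
    intro τ hτ
    have h := hf.im_dirDeriv_mul_conj_nonpos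
      (z := fun j => (x j : ℂ) + v j * ((τ : ℂ) * Complex.I)) (fun j => by
        simpa using mul_nonneg (hv j) hτ.le) hv
    rw [← aeval_realLine, ← aeval_realLine, ← derivative_realLine, ← hp, hpr] at h
    rw [hpq] at h
    simp only [map_add, map_mul, Polynomial.aeval_X, Polynomial.aeval_C, Complex.coe_algebraMap]
      at h
    change ((τ * Complex.I * R τ + (b : ℂ)) * ((starRingEnd ℂ) τ * (starRingEnd ℂ) Complex.I *
      (starRingEnd ℂ) (Q τ) + (starRingEnd ℂ) (a : ℂ))).im ≤ 0 at h
    simp only [Complex.mul_im, Complex.mul_re, Complex.add_re, Complex.add_im, Complex.ofReal_re,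
      Complex.ofReal_im, Complex.I_re, Complex.I_im, Complex.conj_re, Complex.conj_im] at h ⊢
    refine nonpos_of_mul_nonpos_right (a := τ) ?_ hτ
    linarith
  have hc : Continuous fun τ : ℝ =>
      a * (R τ).re - b * (Q τ).re + τ * (R τ * (starRingEnd ℂ) (Q τ)).im :=
    ((continuous_const.mul (Complex.continuous_re.comp hcR)).sub
      (continuous_const.mul (Complex.continuous_re.comp hcQ))).add
      (continuous_id.mul (Complex.continuous_im.comp
        (hcR.mul (Complex.continuous_conj.comp hcQ))))
  have hlim := le_of_tendsto ((hc.tendsto (0 : ℝ)).mono_left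
    (nhdsWithin_le_nhds (s := Set.Ioi 0)))
    (Filter.mem_of_superset self_mem_nhdsWithin fun τ hτ => key τ hτ)
  rw [hQ0, hR0, Complex.ofReal_re, Complex.ofReal_re, zero_mul, add_zero] at hlim
  nlinarith

/-- For `l ≥ 2` the arguments of `l`-th powers of points of the upper half-plane sweep a full turn.
This is what excludes zeros of order two or more in `IsRealStable.dirDeriv_mul_dirDeriv_pos`. -/
theorem exists_upper_pow_eq {l : ℕ} (hl : 2 ≤ l) {c : ℂ} (hc : c = Complex.I ∨ c = -Complex.I) :
    ∃ w : ℂ, 0 < w.im ∧ w ^ l = c := by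
  have hl0 : (0 : ℝ) < l := by positivity
  have hl2 : (2 : ℝ) ≤ l := by exact_mod_cast hl
  have hlC : (l : ℂ) ≠ 0 := by
    have : l ≠ 0 := by omega
    exact_mod_cast this
  have key : ∀ θ : ℝ, 0 < θ → θ < 2 * Real.pi →
      ∃ w : ℂ, 0 < w.im ∧ w ^ l = Complex.exp (θ * Complex.I) := by
    intro θ h0 h1
    refine ⟨Complex.exp ((θ / l : ℝ) * Complex.I), ?_, ?_⟩
    · rw [Complex.exp_ofReal_mul_I_im]
      refine Real.sin_pos_of_pos_of_lt_pi (by positivity) ?_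
      rw [div_lt_iff₀ hl0]
      nlinarith [Real.pi_pos]
    · rw [← Complex.exp_nat_mul]
      congr 1
      push_cast
      field_simp
  rcases hc with rfl | rfl
  · obtain ⟨w, h1, h2⟩ := key (Real.pi / 2) (by positivity) (by linarith [Real.pi_pos])
    refine ⟨w, h1, h2.trans ?_⟩
    push_cast
    exact Complex.exp_pi_div_two_mul_I
  · obtain ⟨w, h1, h2⟩ := key (3 * Real.pi / 2) (by positivity) (by linarith [Real.pi_pos])
    refine ⟨w, h1, h2.trans ?_⟩
    have : ((3 * Real.pi / 2 : ℝ) : ℂ) * Complex.I =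
        Real.pi * Complex.I + Real.pi / 2 * Complex.I := by
      push_cast; ring
    rw [this, Complex.exp_add, Complex.exp_pi_mul_I, Complex.exp_pi_div_two_mul_I]
    ring

/-- At a zero of a stable form that is simple in one positive direction, the derivatives in all
nonnegative directions in which the form does not vanish have the same strict sign. -/
theorem IsRealStable.dirDeriv_mul_dirDeriv_pos {f : MvPolynomial (Fin n) ℝ} {d : ℕ}
    (hf : IsRealStable f) (hd : f.IsHomogeneous d) {u v : Fin n → ℝ} (hu : ∀ j, 0 ≤ u j)
    (hv : ∀ j, 0 ≤ v j) (huf : eval u f ≠ 0) {x : Fin n → ℝ} (hx : eval x f = 0)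
    (hvx : eval x (dirDeriv v f) ≠ 0) :
    0 < eval x (dirDeriv u f) * eval x (dirDeriv v f) := by
  set p := realLine f x u with hp
  set A := realLine (dirDeriv v f) x u with hA
  have hp0 : p ≠ 0 := by
    intro h
    have h1 : lineRestrict f (fun i => (x i : ℂ)) (fun i => (u i : ℂ)) = 0 := by
      refine Polynomial.funext fun t => ?_
      rw [eval_lineRestrict, ← aeval_realLine, ← hp, h]
      simp
    have h2 := coeff_lineRestrict hd (fun i => (x i : ℂ)) (fun i => (u i : ℂ))
    rw [h1, Polynomial.coeff_zero, aeval_ofReal] at h2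
    exact huf (by exact_mod_cast h2.symm)
  obtain ⟨q, hq, hq0⟩ := Polynomial.exists_eq_pow_rootMultiplicity_mul_and_not_dvd p hp0 0
  set l := p.rootMultiplicity 0 with hl
  rw [Polynomial.C_0, sub_zero] at hq hq0
  have hl1 : 1 ≤ l := by
    rw [hl, Nat.one_le_iff_ne_zero, Ne, Polynomial.rootMultiplicity_eq_zero_iff]
    intro h
    refine hp0 (h ?_)
    rw [Polynomial.IsRoot, hp, eval_zero_realLine, hx]
  have hqe : q.eval 0 ≠ 0 := by
    rwa [Ne, ← Polynomial.coeff_zero_eq_eval_zero, ← Polynomial.X_dvd_iff]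
  have hAe : A.eval 0 = eval x (dirDeriv v f) := by rw [hA, eval_zero_realLine]
  -- Approach `x` along `x + τ w u`: there `p` equals `(τ w) ^ l q`. Dividing the boundary
  -- inequality by `τ ^ l` and letting `τ → 0` leaves only the phase of `w ^ l`.
  have hsign : ∀ w : ℂ, 0 < w.im → 0 ≤ A.eval 0 * q.eval 0 * (w ^ l).im := by
    intro w hw
    have hpos : ∀ τ : ℝ, 0 < τ → (Polynomial.aeval ((τ : ℂ) * w) A *
        (starRingEnd ℂ) (w ^ l * Polynomial.aeval ((τ : ℂ) * w) q)).im ≤ 0 := by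
      intro τ hτ
      have h := hf.im_dirDeriv_mul_conj_nonpos (v := v)
        (z := fun j => (x j : ℂ) + u j * ((τ : ℂ) * w)) (fun j => by
          simpa using mul_nonneg (hu j) (mul_nonneg hτ.le hw.le)) hv
      rw [← aeval_realLine, ← aeval_realLine, ← hp, ← hA, hq, map_mul, map_pow, Polynomial.aeval_X,
        mul_pow, mul_assoc, map_mul, map_pow, Complex.conj_ofReal, mul_left_comm,
        ← Complex.ofReal_pow, Complex.im_ofReal_mul] at h
      exact nonpos_of_mul_nonpos_right h (pow_pos hτ l)
    have hc : Continuous fun τ : ℝ => (Polynomial.aeval ((τ : ℂ) * w) A *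
        (starRingEnd ℂ) (w ^ l * Polynomial.aeval ((τ : ℂ) * w) q)).im := by
      refine Complex.continuous_im.comp (Continuous.mul ?_ (Complex.continuous_conj.comp ?_)) <;>
        fun_prop
    have hlim := le_of_tendsto ((hc.tendsto (0 : ℝ)).mono_left
      (nhdsWithin_le_nhds (s := Set.Ioi 0)))
      (Filter.mem_of_superset self_mem_nhdsWithin fun τ hτ => hpos τ hτ)
    have h0 : ∀ s : Polynomial ℝ, Polynomial.aeval (0 : ℂ) s = ((s.eval 0 : ℝ) : ℂ) := by
      intro s
      rw [← Complex.coe_algebraMap, ← Polynomial.aeval_algebraMap_apply_eq_algebraMap_eval]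
      simp
    rw [Complex.ofReal_zero, zero_mul, h0, h0, map_mul, Complex.conj_ofReal,
      Complex.im_ofReal_mul, Complex.im_mul_ofReal, Complex.conj_im] at hlim
    nlinarith
  have hne : A.eval 0 * q.eval 0 ≠ 0 := mul_ne_zero (by rwa [hAe]) hqe
  -- If `l ≥ 2`, then `w ^ l` takes both values `I` and `-I`, forcing the nonzero number `A(0) q(0)`
  -- to vanish.
  have hl2 : l = 1 := by
    by_contra hl2
    obtain ⟨w1, h1, h1'⟩ := exists_upper_pow_eq (l := l) (by omega) (Or.inl rfl)
    obtain ⟨w2, h2, h2'⟩ := exists_upper_pow_eq (l := l) (by omega) (Or.inr rfl)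
    have e1 := hsign w1 h1
    have e2 := hsign w2 h2
    rw [h1'] at e1
    rw [h2'] at e2
    simp only [Complex.I_im, Complex.neg_im] at e1 e2
    exact hne (by linarith)
  have hI := hsign Complex.I (by simp)
  rw [hl2, pow_one, Complex.I_im, mul_one] at hI
  have hder : eval x (dirDeriv u f) = q.eval 0 := by
    rw [← eval_zero_realLine _ x u, ← derivative_realLine, ← hp, hq, hl2]
    simp
  rw [hder, ← hAe, mul_comm]
  exact lt_of_le_of_ne hI hne.symm

end Boundary

end

section

open MvPolynomial

/-! ### The exclusion operator -/

section Exclusion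

variable {n : ℕ}

/-- The derivative in the direction `(1, …, 1)`. -/
noncomputable abbrev diagDeriv : MvPolynomial (Fin n) ℝ →ₗ[ℝ] MvPolynomial (Fin n) ℝ :=
  dirDeriv fun _ => 1

theorem diagDeriv_apply (f : MvPolynomial (Fin n) ℝ) : diagDeriv f = ∑ i, pderiv i f := by
  simp [dirDeriv_apply]

theorem raiseOp_isHomogeneous {h : MvPolynomial (Fin n) ℝ} {d : ℕ} (D : ℕ)
    (hh : h.IsHomogeneous d) : (raiseOp D h).IsHomogeneous (d + 1) := by
  rw [raiseOp_apply]
  refine IsHomogeneous.sum _ _ _ fun i _ => IsHomogeneous.sub ?_ ?_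
  · rw [smul_eq_C_mul, add_comm]
    exact ((isHomogeneous_X ℝ i).mul hh).C_mul _
  · rcases d with _ | d
    · have : pderiv i h = 0 := by
        rw [← totalDegree_zero_iff_isHomogeneous, totalDegree_eq_zero_iff_eq_C] at hh
        rw [hh, pderiv_C]
      rw [this, mul_zero]
      exact isHomogeneous_zero _ _ _
    · have := (isHomogeneous_X_pow (R := ℝ) i 2).mul (hh.pderiv (i := i))
      have h2 : d + 1 + 1 = 2 + (d + 1 - 1) := by omega
      rw [h2]
      exact this

theorem coeff_X_mul_pderiv (i : Fin n) (h : MvPolynomial (Fin n) ℝ) (α : Fin n →₀ ℕ) :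
    coeff α (X i * pderiv i h) = α i * coeff α h := by
  rw [coeff_X_mul']
  split_ifs with hi
  · rw [Finsupp.mem_support_iff] at hi
    have hle : Finsupp.single i 1 ≤ α := by
      rw [Finsupp.single_le_iff]; omega
    rw [coeff_pderiv, tsub_add_cancel_of_le hle, mul_comm]
    congr 1
    have : 1 ≤ α i := by omega
    simp [Nat.cast_sub this]
  · rw [Finsupp.notMem_support_iff] at hi
    simp [hi]

theorem coeff_raiseOp (D : ℕ) (h : MvPolynomial (Fin n) ℝ) (α : Fin n →₀ ℕ) :
    coeff α (raiseOp D h) = ∑ i, if α i = 0 then 0 else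
      ((D : ℝ) - (α i - 1)) * coeff (α - Finsupp.single i 1) h := by
  rw [raiseOp_apply, coeff_sum]
  refine Finset.sum_congr rfl fun i _ => ?_
  rw [coeff_sub, coeff_smul, pow_two, mul_assoc, coeff_X_mul', coeff_X_mul', coeff_X_mul_pderiv]
  by_cases hi : α i = 0
  · simp [hi]
  · have h1 : 1 ≤ α i := by omega
    simp [hi, Nat.cast_sub h1]
    ring

theorem eval_one_diagDeriv {f : MvPolynomial (Fin n) ℝ} {d : ℕ} (hf : f.IsHomogeneous d) :
    eval (fun _ => (1 : ℝ)) (diagDeriv f) = d * eval (fun _ => (1 : ℝ)) f := by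
  have h := congrArg (eval fun _ => (1 : ℝ)) hf.sum_X_mul_pderiv
  rw [diagDeriv_apply]
  simpa using h

theorem eval_one_raiseOp {f : MvPolynomial (Fin n) ℝ} {d : ℕ} (D : ℕ) (hf : f.IsHomogeneous d) :
    eval (fun _ => (1 : ℝ)) (raiseOp D f) = (n * D - d) * eval (fun _ => (1 : ℝ)) f := by
  have h := congrArg (eval fun _ => (1 : ℝ)) hf.sum_X_mul_pderiv
  rw [raiseOp_apply]
  simp only [map_sum, map_mul, eval_X, one_mul, nsmul_eq_mul, map_natCast] at h
  simp only [map_sum, map_sub, smul_eval, map_mul, eval_X, one_mul, map_pow, one_pow,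
    Finset.sum_sub_distrib, h, Finset.sum_const, Finset.card_univ, Fintype.card_fin, nsmul_eq_mul]
  ring

theorem pderiv_comm_apply (i j : Fin n) (f : MvPolynomial (Fin n) ℝ) :
    pderiv i (pderiv j f) = pderiv j (pderiv i f) := by
  ext α
  rw [coeff_pderiv, coeff_pderiv, coeff_pderiv, coeff_pderiv, add_right_comm]
  rcases eq_or_ne i j with rfl | hij
  · rfl
  · simp [hij, hij.symm]
    ring

theorem diagDeriv_mul (f g : MvPolynomial (Fin n) ℝ) :
    diagDeriv (f * g) = diagDeriv f * g + f * diagDeriv g := by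
  simp only [diagDeriv_apply, pderiv_mul, Finset.sum_add_distrib, Finset.sum_mul, Finset.mul_sum]

theorem diagDeriv_X (i : Fin n) : diagDeriv (X i : MvPolynomial (Fin n) ℝ) = 1 := by
  rw [diagDeriv_apply, Finset.sum_eq_single i]
  · simp
  · intro j _ hj
    exact pderiv_X_of_ne hj.symm
  · simp

theorem diagDeriv_pderiv (i : Fin n) (f : MvPolynomial (Fin n) ℝ) :
    diagDeriv (pderiv i f) = pderiv i (diagDeriv f) := by
  rw [diagDeriv_apply, diagDeriv_apply, map_sum]
  exact Finset.sum_congr rfl fun j _ => pderiv_comm_apply j i f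

/-- The `sl₂` relation: the commutator of the lowering and raising operators acts on each degree as
a scalar, by Euler's identity. -/
theorem diagDeriv_raiseOp {f : MvPolynomial (Fin n) ℝ} {d : ℕ} (D : ℕ) (hf : f.IsHomogeneous d) :
    diagDeriv (raiseOp D f) = raiseOp D (diagDeriv f) + ((n : ℝ) * D - 2 * d) • f := by
  have hterm : ∀ i, diagDeriv ((D : ℝ) • (X i * f) - X i ^ 2 * pderiv i f) =
      ((D : ℝ) • (X i * diagDeriv f) - X i ^ 2 * pderiv i (diagDeriv f)) +
        ((D : ℝ) • f - (2 : ℝ) • (X i * pderiv i f)) := by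
    intro i
    rw [map_sub, map_smul, diagDeriv_mul, pow_two, diagDeriv_mul, diagDeriv_mul, diagDeriv_X,
      diagDeriv_pderiv, two_smul]
    simp only [smul_add, one_mul, mul_one]
    ring
  rw [raiseOp_apply, raiseOp_apply, map_sum, Finset.sum_congr rfl fun i _ => hterm i,
    Finset.sum_add_distrib]
  congr 1
  rw [Finset.sum_sub_distrib, ← Finset.smul_sum, ← Finset.smul_sum, hf.sum_X_mul_pderiv, Finset.sum_const,
    Finset.card_univ, Fintype.card_fin, ← Nat.cast_smul_eq_nsmul ℝ n,
    ← Nat.cast_smul_eq_nsmul ℝ d]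
  module

theorem diagDeriv_zero_of_isHomogeneous_zero {f : MvPolynomial (Fin n) ℝ}
    (hf : f.IsHomogeneous 0) : diagDeriv f = 0 := by
  rw [← totalDegree_zero_iff_isHomogeneous, totalDegree_eq_zero_iff_eq_C] at hf
  rw [diagDeriv_apply]
  refine Finset.sum_eq_zero fun i _ => ?_
  rw [hf, pderiv_C]

theorem diagDeriv_isHomogeneous_pred {f : MvPolynomial (Fin n) ℝ} {d : ℕ}
    (hf : f.IsHomogeneous d) : (diagDeriv f).IsHomogeneous (d - 1) := by
  rcases d with _ | d
  · rw [diagDeriv_zero_of_isHomogeneous_zero hf]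
    exact isHomogeneous_zero _ _ _
  · exact dirDeriv_isHomogeneous _ hf

theorem iterate_diagDeriv_isHomogeneous {f : MvPolynomial (Fin n) ℝ} {d : ℕ}
    (hf : f.IsHomogeneous d) (j : ℕ) : ((⇑diagDeriv)^[j] f).IsHomogeneous (d - j) := by
  induction j with
  | zero => exact hf
  | succ j ih =>
    rw [Function.iterate_succ_apply']
    exact diagDeriv_isHomogeneous_pred ih

/-- Iterates the commutator relation. The scalar `κ` is left implicit since the identity is used at
a point where the `j`-th derivative vanishes. -/
theorem exists_iterate_diagDeriv_raiseOp {f : MvPolynomial (Fin n) ℝ} {d : ℕ} (D : ℕ)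
    (hf : f.IsHomogeneous d) (j : ℕ) : ∃ κ : ℝ, (⇑diagDeriv)^[j] (raiseOp D (diagDeriv f)) =
      raiseOp D ((⇑diagDeriv)^[j + 1] f) + κ • (⇑diagDeriv)^[j] f := by
  induction j with
  | zero => exact ⟨0, by simp⟩
  | succ j ih =>
    obtain ⟨κ, hκ⟩ := ih
    refine ⟨(n : ℝ) * D - 2 * ((d - (j + 1) : ℕ) : ℝ) + κ, ?_⟩
    rw [Function.iterate_succ_apply', hκ, map_add, map_smul,
      diagDeriv_raiseOp D (iterate_diagDeriv_isHomogeneous hf (j + 1)), add_smul, add_assoc,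
      ← Function.iterate_succ_apply' (⇑diagDeriv) (j + 1) f,
      ← Function.iterate_succ_apply' (⇑diagDeriv) j f]

theorem eval_raiseOp_of_eval_eq_zero (D : ℕ) {h : MvPolynomial (Fin n) ℝ} {x : Fin n → ℝ}
    (hx : eval x h = 0) : eval x (raiseOp D h) = -eval x (dirDeriv (fun i => x i ^ 2) h) := by
  rw [raiseOp_apply, dirDeriv_apply, map_sum, map_sum, ← Finset.sum_neg_distrib]
  refine Finset.sum_congr rfl fun i _ => ?_
  simp [hx, smul_eval]

/-! #### Positivity -/

/-- The form `f` has positive coefficients at all exponents of degree `d`. -/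
def HasPosCoeffs (d : ℕ) (f : MvPolynomial (Fin n) ℝ) : Prop :=
  ∀ α : Fin n →₀ ℕ, α.degree = d → 0 < coeff α f

theorem HasPosCoeffs.hasPosCoeffs_diagDeriv [NeZero n] {d : ℕ} {f : MvPolynomial (Fin n) ℝ}
    (hf : HasPosCoeffs (d + 1) f) : HasPosCoeffs d (diagDeriv f) := by
  intro α hα
  rw [coeff_dirDeriv]
  refine Finset.sum_pos (fun i _ => ?_) Finset.univ_nonempty
  rw [one_mul]
  refine mul_pos (hf _ ?_) (by positivity)
  simp [hα]

theorem HasPosCoeffs.hasPosCoeffs_iterate [NeZero n] {d : ℕ} (j : ℕ) {f : MvPolynomial (Fin n) ℝ}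
    (hf : HasPosCoeffs (d + j) f) : HasPosCoeffs d ((⇑diagDeriv)^[j] f) := by
  induction j generalizing f with
  | zero => exact hf
  | succ j ih =>
    rw [Function.iterate_succ_apply]
    exact ih (HasPosCoeffs.hasPosCoeffs_diagDeriv hf)

theorem HasPosCoeffs.eval_pos {d : ℕ} {f : MvPolynomial (Fin n) ℝ} (hf : HasPosCoeffs d f)
    (hd : f.IsHomogeneous d) {y : Fin n → ℝ} (hy : ∀ j, 0 ≤ y j) (hy0 : y ≠ 0) :
    0 < eval y f := by
  obtain ⟨i, hi⟩ : ∃ i, y i ≠ 0 := by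
    by_contra h
    push Not at h
    exact hy0 (funext h)
  have hnn : ∀ α, 0 ≤ coeff α f := fun α => by
    by_cases h : α.degree = d
    · exact (hf α h).le
    · rw [hd.coeff_eq_zero h]
  have hpos := hf (Finsupp.single i d) (by simp)
  rw [eval_eq']
  refine Finset.sum_pos' (fun α _ => mul_nonneg (hnn α)
    (Finset.prod_nonneg fun j _ => pow_nonneg (hy j) _)) ⟨Finsupp.single i d, ?_, ?_⟩
  · exact mem_support_iff.2 hpos.ne'
  · refine mul_pos hpos (Finset.prod_pos fun j _ => ?_)
    rcases eq_or_ne j i with rfl | hj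
    · exact pow_pos ((hy j).lt_of_ne' hi) _
    · simp [hj.symm]

theorem coeff_raiseOp_nonneg {k : ℕ} {h : MvPolynomial (Fin n) ℝ} (hd : h.IsHomogeneous k)
    (hnn : ∀ α, 0 ≤ coeff α h) (α : Fin n →₀ ℕ) : 0 ≤ coeff α (raiseOp (k + 1) h) := by
  by_cases hα : α.degree = k + 1
  · rw [coeff_raiseOp]
    refine Finset.sum_nonneg fun i _ => ?_
    split_ifs
    · exact le_rfl
    · have h1 : (α i : ℝ) ≤ (k + 1 : ℕ) := by
        exact_mod_cast hα ▸ Finsupp.le_degree i α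
      exact mul_nonneg (by linarith) (hnn _)
  · rw [(raiseOp_isHomogeneous _ hd).coeff_eq_zero hα]

/-- Any two exponents of the same degree are joined by moves of a single unit from one variable to
another, so vanishing spreads. The common part `γ` is carried along to make the induction work. -/
theorem coeff_eq_zero_of_exchange {f : MvPolynomial (Fin n) ℝ}
    (h : ∀ (γ : Fin n →₀ ℕ) (i j : Fin n), coeff (γ + Finsupp.single j 1) f = 0 →
      coeff (γ + Finsupp.single i 1) f = 0) (k : ℕ) :
    ∀ γ α β : Fin n →₀ ℕ, α.degree = k → β.degree = k → coeff (γ + α) f = 0 →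
      coeff (γ + β) f = 0 := by
  induction k with
  | zero =>
    intro γ α β hα hβ h0
    rw [Finsupp.degree_eq_zero_iff] at hα hβ
    rwa [hβ, ← hα]
  | succ k ih =>
    have split : ∀ α : Fin n →₀ ℕ, α.degree = k + 1 →
        ∃ (i : Fin n) (α' : Fin n →₀ ℕ), α'.degree = k ∧ α = α' + Finsupp.single i 1 := by
      intro α hα
      have hα0 : α ≠ 0 := by rintro rfl; simp at hα
      obtain ⟨i, hi⟩ := Finsupp.ne_iff.1 hα0
      have hle : Finsupp.single i 1 ≤ α := by
        rw [Finsupp.single_le_iff]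
        simp at hi
        omega
      refine ⟨i, α - Finsupp.single i 1, ?_, (tsub_add_cancel_of_le hle).symm⟩
      have h2 := congrArg Finsupp.degree (tsub_add_cancel_of_le hle)
      rw [map_add, Finsupp.degree_single, hα] at h2
      omega
    intro γ α β hα hβ h0
    obtain ⟨j, α', hα', rfl⟩ := split α hα
    obtain ⟨i, β', hβ', rfl⟩ := split β hβ
    rw [← add_assoc] at h0
    have h1 := h _ i j h0
    rw [add_right_comm] at h1
    have h2 := ih _ _ β' hα' hβ' h1
    rwa [add_assoc, add_comm (Finsupp.single i 1)] at h2

/-- A strong minimum principle. At a vanishing coefficient, the coefficient of `R ∂f` is a sum of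
nonnegative terms involving the coefficients one exchange away; if it is nonpositive, those vanish
too, and by connectedness `f = 0`. -/
theorem hasPosCoeffs_of_coeff_raiseOp {k : ℕ} {f : MvPolynomial (Fin n) ℝ}
    (hd : f.IsHomogeneous (k + 1)) (hnn : ∀ α, 0 ≤ coeff α f) (h0 : f ≠ 0)
    (h : ∀ α, coeff α f = 0 → coeff α (raiseOp (k + 1) (diagDeriv f)) ≤ 0) :
    HasPosCoeffs (k + 1) f := by
  have hdd : (diagDeriv f).IsHomogeneous k := dirDeriv_isHomogeneous _ hd
  have hdnn : ∀ α, 0 ≤ coeff α (diagDeriv f) := fun α => by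
    rw [coeff_dirDeriv]
    exact Finset.sum_nonneg fun i _ => by
      rw [one_mul]; exact mul_nonneg (hnn _) (by positivity)
  have hex : ∀ (γ : Fin n →₀ ℕ) (i j : Fin n), coeff (γ + Finsupp.single j 1) f = 0 →
      coeff (γ + Finsupp.single i 1) f = 0 := by
    intro γ i j hγ
    by_cases hdeg : γ.degree = k
    swap
    · exact hd.coeff_eq_zero (by simp [hdeg])
    have hle : ∀ l, γ l ≤ k := fun l => hdeg ▸ Finsupp.le_degree l γ
    have h1 := h _ hγ
    rw [coeff_raiseOp] at h1
    have hterm : ∀ l, 0 ≤ if (γ + Finsupp.single j 1 : Fin n →₀ ℕ) l = 0 then (0 : ℝ) else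
        (((k + 1 : ℕ) : ℝ) - (((γ + Finsupp.single j 1 : Fin n →₀ ℕ) l : ℕ) - 1)) *
          coeff (γ + Finsupp.single j 1 - Finsupp.single l 1) (diagDeriv f) := by
      intro l
      split_ifs
      · exact le_rfl
      · refine mul_nonneg ?_ (hdnn _)
        have h2 : (γ + Finsupp.single j 1 : Fin n →₀ ℕ) l ≤ k + 1 := by
          have := hle l
          rw [Finsupp.add_apply, Finsupp.single_apply]
          split_ifs <;> omega
        have h3 : (((γ + Finsupp.single j 1 : Fin n →₀ ℕ) l : ℕ) : ℝ) ≤ ((k + 1 : ℕ) : ℝ) := by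
          exact_mod_cast h2
        linarith
    have h2 := (Finset.sum_eq_zero_iff_of_nonneg fun l _ => hterm l).1
      (le_antisymm h1 (Finset.sum_nonneg fun l _ => hterm l)) j (Finset.mem_univ j)
    rw [if_neg (by simp), add_tsub_cancel_right] at h2
    have h3 : coeff γ (diagDeriv f) = 0 := by
      -- The factor is `k + 1 - γ j`, positive because `γ j ≤ k`. With `D = k` it would vanish at
      -- pure powers, whence the choice `D = k + 1`.
      refine (mul_eq_zero.1 h2).resolve_left ?_
      have : (γ j : ℝ) ≤ k := by exact_mod_cast hle j
      simp only [Finsupp.add_apply, Finsupp.single_eq_same]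
      push_cast
      linarith
    rw [coeff_dirDeriv] at h3
    have h4 := (Finset.sum_eq_zero_iff_of_nonneg fun l _ => by
      rw [one_mul]; exact mul_nonneg (hnn _) (by positivity)).1 h3 i (Finset.mem_univ i)
    rw [one_mul] at h4
    exact (mul_eq_zero.1 h4).resolve_right (by positivity)
  intro α hα
  refine (hnn α).lt_of_ne' fun hα0 => h0 ?_
  ext β
  rw [coeff_zero]
  by_cases hβ : β.degree = k + 1
  · have := coeff_eq_zero_of_exchange hex (k + 1) 0 α β hα hβ (by rwa [zero_add])
    rwa [zero_add] at this
  · exact hd.coeff_eq_zero hβ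

end Exclusion

end

section

open MvPolynomial

/-! ### The invariant form and the eigenbasis -/

section Form

variable {n : ℕ}

/-- The exponents of degree `d`. -/
noncomputable def exponents (n d : ℕ) : Finset (Fin n →₀ ℕ) :=
  Finset.finsuppAntidiag Finset.univ d

theorem mem_exponents {d : ℕ} {α : Fin n →₀ ℕ} : α ∈ exponents n d ↔ α.degree = d := by
  simp [exponents, Finset.mem_finsuppAntidiag, Finsupp.degree_eq_sum]

/-- The product of the binomial coefficients `D.choose (α i)`. -/
noncomputable def binomWeight (D : ℕ) (α : Fin n →₀ ℕ) : ℝ := ∏ i, (D.choose (α i) : ℝ)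

theorem binomWeight_pos {D : ℕ} {α : Fin n →₀ ℕ} (h : α.degree ≤ D) : 0 < binomWeight D α :=
  Finset.prod_pos fun i _ => by
    exact_mod_cast Nat.choose_pos ((Finsupp.le_degree i α).trans h)

theorem binomWeight_add_single {D : ℕ} {β : Fin n →₀ ℕ} (i : Fin n) (h : β.degree ≤ D) :
    binomWeight D (β + Finsupp.single i 1) * (β i + 1) = binomWeight D β * (D - β i) := by
  have hi : β i ≤ D := (Finsupp.le_degree i β).trans h
  unfold binomWeight
  rw [← Finset.mul_prod_erase _ _ (Finset.mem_univ i),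
    ← Finset.mul_prod_erase (a := i) _ (fun j => (D.choose (β j) : ℝ)) (Finset.mem_univ i)]
  have h1 : ∏ j ∈ Finset.univ.erase i,
      (D.choose ((β + Finsupp.single i 1 : Fin n →₀ ℕ) j) : ℝ) =
      ∏ j ∈ Finset.univ.erase i, (D.choose (β j) : ℝ) := by
    refine Finset.prod_congr rfl fun j hj => ?_
    rw [Finsupp.add_apply, Finsupp.single_eq_of_ne (Finset.ne_of_mem_erase hj), add_zero]
  have h2 : (D.choose (β i + 1) : ℝ) * (β i + 1) = D.choose (β i) * (D - β i) := by
    have := Nat.choose_succ_right_eq D (β i)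
    rw [← Nat.cast_sub hi]
    exact_mod_cast this
  rw [h1, Finsupp.add_apply, Finsupp.single_eq_same, mul_right_comm, h2]
  ring

/-- The inner product on forms of degree `d` for which the monomials are orthogonal and
`‖w ^ α‖² = (binomWeight D α)⁻¹`. -/
noncomputable def binomForm (D d : ℕ) (f g : MvPolynomial (Fin n) ℝ) : ℝ :=
  ∑ α ∈ exponents n d, coeff α f * coeff α g / binomWeight D α

theorem binomForm_comm (D d : ℕ) (f g : MvPolynomial (Fin n) ℝ) :
    binomForm D d f g = binomForm D d g f :=
  Finset.sum_congr rfl fun α _ => by rw [mul_comm (coeff α f)]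

theorem binomForm_add_left (D d : ℕ) (f g h : MvPolynomial (Fin n) ℝ) :
    binomForm D d (f + g) h = binomForm D d f h + binomForm D d g h := by
  simp [binomForm, add_mul, add_div, Finset.sum_add_distrib]

theorem binomForm_smul_left (D d : ℕ) (r : ℝ) (f g : MvPolynomial (Fin n) ℝ) :
    binomForm D d (r • f) g = r * binomForm D d f g := by
  simp [binomForm, mul_assoc, mul_div_assoc, Finset.mul_sum]

theorem binomForm_self_nonneg {D d : ℕ} (h : d ≤ D) (f : MvPolynomial (Fin n) ℝ) :
    0 ≤ binomForm D d f f :=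
  Finset.sum_nonneg fun _ hα => div_nonneg (mul_self_nonneg _)
    (binomWeight_pos ((mem_exponents.1 hα).trans_le h)).le

theorem eq_zero_of_binomForm_self {D d : ℕ} (h : d ≤ D) {f : MvPolynomial (Fin n) ℝ}
    (hf : f.IsHomogeneous d) (h0 : binomForm D d f f = 0) : f = 0 := by
  ext α
  rw [coeff_zero]
  by_cases hα : α.degree = d
  · have h1 := (Finset.sum_eq_zero_iff_of_nonneg fun β hβ => div_nonneg (mul_self_nonneg (coeff β f))
      (binomWeight_pos ((mem_exponents.1 hβ).trans_le h)).le).1 h0 α (mem_exponents.2 hα)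
    have h2 := (binomWeight_pos (D := D) (α := α) (hα.trans_le h)).ne'
    simpa [h2] using h1
  · exact hf.coeff_eq_zero hα

/-- Raising and lowering are adjoint. Substituting `α = β + eᵢ` matches the terms, and
`binomWeight_add_single` is exactly the required ratio of weights. -/
theorem binomForm_raiseOp {D k : ℕ} (hk : k ≤ D) (h f : MvPolynomial (Fin n) ℝ)
    (hD : k + 1 ≤ D) :
    binomForm D (k + 1) (raiseOp D h) f = binomForm D k h (diagDeriv f) := by
  classical
  unfold binomForm
  simp_rw [coeff_raiseOp, coeff_dirDeriv, Finset.sum_mul, Finset.mul_sum, Finset.sum_div, one_mul]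
  rw [Finset.sum_comm, Finset.sum_comm (s := exponents n k)]
  refine Finset.sum_congr rfl fun i _ => ?_
  let e : (Fin n →₀ ℕ) ↪ (Fin n →₀ ℕ) := addRightEmbedding (Finsupp.single i 1)
  have hsub : (exponents n k).map e ⊆ exponents n (k + 1) := by
    intro α hα
    obtain ⟨β, hβ, rfl⟩ := Finset.mem_map.1 hα
    rw [mem_exponents] at hβ ⊢
    simp [e, hβ]
  rw [← Finset.sum_subset hsub, Finset.sum_map]
  · refine Finset.sum_congr rfl fun β hβ => ?_
    rw [mem_exponents] at hβ
    have hw := binomWeight_add_single (D := D) i (hβ.trans_le hk)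
    have h1 := (binomWeight_pos (D := D) (hβ.trans_le hk)).ne'
    have h2 : binomWeight D (β + Finsupp.single i 1) ≠ 0 :=
      (binomWeight_pos (by simpa [hβ] using hD)).ne'
    simp only [e, addRightEmbedding_apply]
    rw [if_neg (by simp), add_tsub_cancel_right, div_eq_div_iff h2 h1]
    simp only [Finsupp.add_apply, Finsupp.single_eq_same]
    push_cast
    linear_combination (-coeff β h * coeff (β + Finsupp.single i 1) f) * hw
  · intro α hα hα'
    rw [if_pos, zero_mul, zero_div]
    by_contra hi
    have hle : Finsupp.single i 1 ≤ α := by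
      rw [Finsupp.single_le_iff]; omega
    refine hα' (Finset.mem_map.2 ⟨α - Finsupp.single i 1, ?_, tsub_add_cancel_of_le hle⟩)
    have h2 := congrArg Finsupp.degree (tsub_add_cancel_of_le hle)
    rw [map_add, Finsupp.degree_single, mem_exponents.1 hα] at h2
    rw [mem_exponents]
    omega

/-! ### Self-adjointness and the top of the spectrum -/

/-- The exclusion operator on forms of degree `k + 1`. -/
noncomputable def exclusionOp (k : ℕ) : MvPolynomial (Fin n) ℝ →ₗ[ℝ] MvPolynomial (Fin n) ℝ :=
  (raiseOp (k + 1)).comp diagDeriv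

theorem exclusionOp_apply (k : ℕ) (f : MvPolynomial (Fin n) ℝ) :
    exclusionOp k f = raiseOp (k + 1) (diagDeriv f) := rfl

theorem exclusionOp_isHomogeneous {k : ℕ} {f : MvPolynomial (Fin n) ℝ}
    (hf : f.IsHomogeneous (k + 1)) : (exclusionOp k f).IsHomogeneous (k + 1) :=
  raiseOp_isHomogeneous _ (dirDeriv_isHomogeneous _ hf)

theorem coeff_exclusionOp_nonneg {k : ℕ} {f : MvPolynomial (Fin n) ℝ}
    (hf : f.IsHomogeneous (k + 1)) (hnn : ∀ α, 0 ≤ coeff α f) (α : Fin n →₀ ℕ) :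
    0 ≤ coeff α (exclusionOp k f) := by
  refine coeff_raiseOp_nonneg (dirDeriv_isHomogeneous _ hf) (fun β => ?_) α
  rw [coeff_dirDeriv]
  exact Finset.sum_nonneg fun i _ => by
    rw [one_mul]; exact mul_nonneg (hnn _) (by positivity)

theorem binomForm_exclusionOp (k : ℕ) (f g : MvPolynomial (Fin n) ℝ) :
    binomForm (k + 1) (k + 1) (exclusionOp k f) g =
      binomForm (k + 1) (k + 1) f (exclusionOp k g) := by
  rw [binomForm_comm _ _ f, exclusionOp_apply, exclusionOp_apply,
    binomForm_raiseOp (Nat.le_succ k) _ _ le_rfl, binomForm_raiseOp (Nat.le_succ k) _ _ le_rfl,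
    binomForm_comm]

/-- The largest eigenvalue of the exclusion operator. -/
noncomputable def exclusionRate (n k : ℕ) : ℝ := (n * (k + 1) - k) * (k + 1)

theorem exclusionRate_nonneg [NeZero n] (k : ℕ) : 0 ≤ exclusionRate n k := by
  have hn : (1 : ℝ) ≤ n := by exact_mod_cast NeZero.one_le
  unfold exclusionRate
  have : (0 : ℝ) ≤ k := k.cast_nonneg
  refine mul_nonneg ?_ (by positivity)
  nlinarith

theorem eval_one_exclusionOp {k : ℕ} {f : MvPolynomial (Fin n) ℝ}
    (hf : f.IsHomogeneous (k + 1)) : eval (fun _ => (1 : ℝ)) (exclusionOp k f) =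
      exclusionRate n k * eval (fun _ => (1 : ℝ)) f := by
  rw [exclusionOp_apply, eval_one_raiseOp _ (dirDeriv_isHomogeneous _ hf), eval_one_diagDeriv hf,
    exclusionRate]
  push_cast
  ring

theorem eval_one_eq_sum {d : ℕ} {f : MvPolynomial (Fin n) ℝ} (hf : f.IsHomogeneous d) :
    eval (fun _ => (1 : ℝ)) f = ∑ α ∈ exponents n d, coeff α f := by
  rw [eval_eq']
  simp only [one_pow, Finset.prod_const_one, mul_one]
  refine Finset.sum_subset (fun α hα => ?_) fun α _ hα => notMem_support_iff.1 hα
  rw [mem_exponents]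
  by_contra h
  exact mem_support_iff.1 hα (hf.coeff_eq_zero h)

/-- The stationary form, whose coefficients are the binomial weights. -/
noncomputable def stationaryForm (n k : ℕ) : MvPolynomial (Fin n) ℝ :=
  ∑ α ∈ exponents n (k + 1), monomial α (binomWeight (k + 1) α)

theorem coeff_stationaryForm {k : ℕ} {α : Fin n →₀ ℕ} (hα : α.degree = k + 1) :
    coeff α (stationaryForm n k) = binomWeight (k + 1) α := by
  classical
  rw [stationaryForm, coeff_sum, Finset.sum_eq_single α]
  · simp
  · intro β _ hβ
    rw [coeff_monomial, if_neg hβ]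
  · intro h
    exact absurd (mem_exponents.2 hα) h

theorem stationaryForm_isHomogeneous (n k : ℕ) : (stationaryForm n k).IsHomogeneous (k + 1) :=
  IsHomogeneous.sum _ _ _ fun _ hα => isHomogeneous_monomial _ (mem_exponents.1 hα)

theorem binomForm_stationaryForm {k : ℕ} {f : MvPolynomial (Fin n) ℝ}
    (hf : f.IsHomogeneous (k + 1)) : binomForm (k + 1) (k + 1) (stationaryForm n k) f =
      eval (fun _ => (1 : ℝ)) f := by
  rw [eval_one_eq_sum hf]
  refine Finset.sum_congr rfl fun α hα => ?_
  have hα' := mem_exponents.1 hα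
  rw [coeff_stationaryForm hα', mul_div_cancel_left₀]
  exact (binomWeight_pos hα'.le).ne'

theorem binomForm_monomial {k : ℕ} (f : MvPolynomial (Fin n) ℝ) {α : Fin n →₀ ℕ}
    (hα : α.degree = k + 1) : binomForm (k + 1) (k + 1) f (monomial α 1) =
      coeff α f / binomWeight (k + 1) α := by
  classical
  rw [binomForm, Finset.sum_eq_single α]
  · simp
  · intro β _ hβ
    rw [coeff_monomial, if_neg hβ.symm]
    simp
  · intro h
    exact absurd (mem_exponents.2 hα) h

/-- Evaluation at `(1, …, 1)` is pairing with the stationary form, and it is multiplied by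
`exclusionRate n k` under the operator. Self-adjointness, tested on monomials, turns this into an
eigenvector equation. -/
theorem exclusionOp_stationaryForm (n k : ℕ) :
    exclusionOp k (stationaryForm n k) = exclusionRate n k • stationaryForm n k := by
  have hP := stationaryForm_isHomogeneous n k
  ext α
  rw [coeff_smul]
  by_cases hα : α.degree = k + 1
  · have hm : (monomial α (1 : ℝ)).IsHomogeneous (k + 1) := isHomogeneous_monomial _ hα
    have h := binomForm_exclusionOp k (stationaryForm n k) (monomial α 1)
    rw [binomForm_stationaryForm (exclusionOp_isHomogeneous hm), eval_one_exclusionOp hm,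
      ← binomForm_stationaryForm hm, binomForm_monomial _ hα, binomForm_monomial _ hα,
      ← mul_div_assoc, div_left_inj' (binomWeight_pos hα.le).ne'] at h
    exact h
  · rw [(exclusionOp_isHomogeneous hP).coeff_eq_zero hα, hP.coeff_eq_zero hα, smul_zero]

theorem eval_one_stationaryForm_pos (n : ℕ) [NeZero n] (k : ℕ) :
    0 < eval (fun _ => (1 : ℝ)) (stationaryForm n k) := by
  rw [eval_one_eq_sum (stationaryForm_isHomogeneous n k)]
  refine Finset.sum_pos (fun β hβ => ?_)
    ⟨Finsupp.single 0 (k + 1), mem_exponents.2 (by simp)⟩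
  rw [coeff_stationaryForm (mem_exponents.1 hβ)]
  exact binomWeight_pos (mem_exponents.1 hβ).le

/-- Every eigenvalue of the exclusion operator on the forms that vanish at `(1, …, 1)` is smaller
than `exclusionRate n k`. -/
theorem eq_zero_of_exclusionOp_eq [NeZero n] {k : ℕ} {v : MvPolynomial (Fin n) ℝ} {μ : ℝ}
    (hv : v.IsHomogeneous (k + 1)) (h1 : eval (fun _ => (1 : ℝ)) v = 0)
    (hA : exclusionOp k v = μ • v) (hμ : exclusionRate n k ≤ μ) : v = 0 := by
  have hP := stationaryForm_isHomogeneous n k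
  have hne : (exponents n (k + 1)).Nonempty :=
    ⟨Finsupp.single 0 (k + 1), mem_exponents.2 (by simp)⟩
  -- Subtracting from `v` the least ratio `ρ` times the stationary form leaves a nonnegative form
  -- with a vanishing coefficient. Since the coefficients of `v` sum to zero, `ρ ≤ 0`.
  obtain ⟨α, hα, hmin⟩ := (exponents n (k + 1)).exists_min_image
    (fun α => coeff α v / binomWeight (k + 1) α) hne
  rw [mem_exponents] at hα
  set ρ := coeff α v / binomWeight (k + 1) α with hρ
  have hmin' : ∀ β, β.degree = k + 1 → ρ * binomWeight (k + 1) β ≤ coeff β v := by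
    intro β hβ
    have := hmin β (mem_exponents.2 hβ)
    rwa [le_div_iff₀ (binomWeight_pos hβ.le)] at this
  have hρ0 : ρ ≤ 0 := by
    by_contra hpos
    rw [eval_one_eq_sum hv] at h1
    refine (Finset.sum_pos (fun β hβ => ?_) hne).ne' h1
    rw [mem_exponents] at hβ
    exact (mul_pos (not_le.1 hpos) (binomWeight_pos hβ.le)).trans_le (hmin' β hβ)
  set f := v - ρ • stationaryForm n k with hf
  have hfd : f.IsHomogeneous (k + 1) := by
    refine hv.sub ?_
    rw [smul_eq_C_mul]
    exact hP.C_mul _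
  have hfc : ∀ β, β.degree = k + 1 → coeff β f = coeff β v - ρ * binomWeight (k + 1) β := by
    intro β hβ
    rw [hf, coeff_sub, coeff_smul, coeff_stationaryForm hβ, smul_eq_mul]
  have hnn : ∀ β, 0 ≤ coeff β f := by
    intro β
    by_cases hβ : β.degree = k + 1
    · rw [hfc β hβ]
      exact sub_nonneg.2 (hmin' β hβ)
    · rw [hfd.coeff_eq_zero hβ]
  have hα0 : coeff α f = 0 := by
    rw [hfc α hα, hρ, div_mul_cancel₀ _ (binomWeight_pos hα.le).ne', sub_self]
  have hf0 : f = 0 := by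
    by_contra h0
    refine (hasPosCoeffs_of_coeff_raiseOp hfd hnn h0 (fun β hβ => ?_) α hα).ne' hα0
    by_cases hβd : β.degree = k + 1
    · rw [hfc β hβd, sub_eq_zero] at hβ
      -- Where `f` has a zero coefficient, its image has coefficient `(μ - exclusionRate n k) * ρ`
      -- times the weight. This is nonpositive, so the minimum principle applies.
      rw [← exclusionOp_apply, hf, map_sub, map_smul, hA, exclusionOp_stationaryForm, coeff_sub,
        coeff_smul, coeff_smul, coeff_smul, coeff_stationaryForm hβd, hβ]
      simp only [smul_eq_mul]
      nlinarith [mul_nonneg (mul_nonneg (sub_nonneg.2 hμ) (neg_nonneg.2 hρ0))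
        (binomWeight_pos (D := k + 1) hβd.le).le]
    · rw [← exclusionOp_apply, (exclusionOp_isHomogeneous hfd).coeff_eq_zero hβd]
  have hvP : v = ρ • stationaryForm n k := sub_eq_zero.1 hf0
  rw [hvP, smul_eval, mul_eq_zero] at h1
  rw [hvP, h1.resolve_right (eval_one_stationaryForm_pos n k).ne', zero_smul]

end Form

/-! ### Diagonalization for a positive definite form -/

section Eigen

/-- An endomorphism that is self-adjoint for a positive definite symmetric form has an
eigenbasis. -/
theorem exists_basis_eigenvectors {V : Type*} [AddCommGroup V] [Module ℝ V] [FiniteDimensional ℝ V]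
    (B : V → V → ℝ) (hadd : ∀ x y z, B (x + y) z = B x z + B y z)
    (hsmul : ∀ (r : ℝ) x y, B (r • x) y = r * B x y) (hcomm : ∀ x y, B x y = B y x)
    (hnn : ∀ x, 0 ≤ B x x) (hdef : ∀ x, B x x = 0 → x = 0) (A : V →ₗ[ℝ] V)
    (hA : ∀ x y, B (A x) y = B x (A y)) :
    ∃ (m : ℕ) (b : Module.Basis (Fin m) ℝ V) (μ : Fin m → ℝ), ∀ i, A (b i) = μ i • b i := by
  let core : InnerProductSpace.Core ℝ V :=
    { inner := B
      conj_inner_symm := fun x y => by simp [hcomm y x]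
      re_inner_nonneg := fun x => by simpa using hnn x
      add_left := hadd
      smul_left := fun x y r => by simp [hsmul]
      definite := hdef }
  let _ : NormedAddCommGroup V := core.toNormedAddCommGroup
  let _ : InnerProductSpace ℝ V := InnerProductSpace.ofCore core.toCore
  have hsym : A.IsSymmetric := hA
  refine ⟨Module.finrank ℝ V, (hsym.eigenvectorBasis rfl).toBasis, hsym.eigenvalues rfl,
    fun i => ?_⟩
  simp

end Eigen

end

section

open MvPolynomial Filter Topology

/-! ### The exclusion flow on stable forms -/

section ExclusionFlow

variable {n : ℕ}

theorem IsStableForm.isStableForm_iterate {d : ℕ} (j : ℕ) {f : MvPolynomial (Fin n) ℝ}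
    (hf : IsStableForm (d + j) f) : IsStableForm d ((⇑diagDeriv)^[j] f) := by
  induction j generalizing f with
  | zero => exact hf
  | succ j ih =>
    rw [Function.iterate_succ_apply]
    exact ih (IsStableForm.isStableForm_dirDeriv (d := d + j) hf fun _ => one_pos)

/-- Affine eigencoordinates for the exclusion operator on forms of degree `k + 1`. -/
structure EigenChart (n k m : ℕ) where
  /-- the stationary form -/
  center : MvPolynomial (Fin n) ℝ
  /-- the eigenvectors -/
  vec : Fin m → MvPolynomial (Fin n) ℝ
  /-- the rates of decay -/
  rate : Fin m → ℝ
  center_hom : center.IsHomogeneous (k + 1)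
  vec_hom : ∀ i, (vec i).IsHomogeneous (k + 1)
  center_eval : eval (fun _ => (1 : ℝ)) center = 1
  vec_eval : ∀ i, eval (fun _ => (1 : ℝ)) (vec i) = 0
  rate_pos : ∀ i, 0 < rate i
  op_center : exclusionOp k center = exclusionRate n k • center
  op_vec : ∀ i, exclusionOp k (vec i) = (exclusionRate n k - rate i) • vec i

namespace EigenChart

variable {k m : ℕ} (c : EigenChart n k m)

/-- The form with coordinates `x`. -/
noncomputable def form (x : Fin m → ℝ) : MvPolynomial (Fin n) ℝ := c.center + ∑ i, x i • c.vec i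

theorem form_isHomogeneous (x : Fin m → ℝ) : (c.form x).IsHomogeneous (k + 1) := by
  refine c.center_hom.add (IsHomogeneous.sum _ _ _ fun i _ => ?_)
  rw [smul_eq_C_mul]
  exact (c.vec_hom i).C_mul _

theorem eval_one_form (x : Fin m → ℝ) : eval (fun _ => (1 : ℝ)) (c.form x) = 1 := by
  simp [form, c.center_eval, smul_eval, c.vec_eval]

theorem form_ne_zero (x : Fin m → ℝ) : c.form x ≠ 0 := fun h => by
  have := c.eval_one_form x
  simp [h] at this

theorem map_form (l : MvPolynomial (Fin n) ℝ →ₗ[ℝ] ℝ) (x : Fin m → ℝ) :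
    l (c.form x) = l c.center + ∑ i, x i * l (c.vec i) := by
  simp [form]

theorem continuous_map_form (l : MvPolynomial (Fin n) ℝ →ₗ[ℝ] ℝ) :
    Continuous fun x => l (c.form x) := by
  simp_rw [map_form]
  fun_prop

theorem aeval_form (z : Fin n → ℂ) (x : Fin m → ℝ) :
    aeval z (c.form x) = aeval z c.center + ∑ i, (x i : ℂ) * aeval z (c.vec i) := by
  simp [form]

/-- The coordinates of the stable forms. -/
def stableSet : Set (Fin m → ℝ) := {x | IsStableForm (k + 1) (c.form x)}

/-- Nonvanishing is an open-looking condition; the lower bound `f y ≤ |f (a + i y)|` replaces it by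
conditions closed in the coefficients. The converse uses that normalized forms are nonzero, so
nonnegative coefficients give `f y > 0`. -/
theorem isStableForm_iff (x : Fin m → ℝ) : IsStableForm (k + 1) (c.form x) ↔
    (∀ α, 0 ≤ coeff α (c.form x)) ∧ ∀ a y : Fin n → ℝ, (∀ j, 0 < y j) →
      eval y (c.form x) ≤ ‖aeval (fun j => (a j : ℂ) + y j * Complex.I) (c.form x)‖ := by
  constructor
  · intro h
    exact ⟨h.coeff_nonneg, fun a y hy => h.stable.eval_le_norm h.homogeneous a hy⟩
  · rintro ⟨h1, h2⟩
    refine ⟨c.form_isHomogeneous x, fun z hz h0 => ?_, h1⟩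
    have h3 := h2 (fun j => (z j).re) (fun j => (z j).im) hz
    simp_rw [Complex.re_add_im] at h3
    rw [h0, norm_zero] at h3
    exact absurd (eval_pos_of_coeff_nonneg h1 (c.form_ne_zero x) hz) (not_lt.2 h3)

theorem continuous_eval_form (y : Fin n → ℝ) : Continuous fun x => eval y (c.form x) :=
  c.continuous_map_form (aeval y : MvPolynomial (Fin n) ℝ →ₐ[ℝ] ℝ).toLinearMap

theorem continuous_coeff_form (α : Fin n →₀ ℕ) : Continuous fun x => coeff α (c.form x) :=
  c.continuous_map_form (lcoeff ℝ α)

theorem isClosed_stableSet : IsClosed c.stableSet := by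
  have h : c.stableSet = (⋂ α, {x | 0 ≤ coeff α (c.form x)}) ∩
      ⋂ (a : Fin n → ℝ) (y : Fin n → ℝ) (_ : ∀ j, 0 < y j), {x | eval y (c.form x) ≤
        ‖aeval (fun j => (a j : ℂ) + y j * Complex.I) (c.form x)‖} := by
    ext x
    simp only [stableSet, Set.mem_ofPred_eq, isStableForm_iff, Set.mem_inter_iff, Set.mem_iInter]
  rw [h]
  refine (isClosed_iInter fun α => isClosed_le continuous_const (c.continuous_coeff_form α)).inter
    (isClosed_iInter fun a => isClosed_iInter fun y => isClosed_iInter fun _ =>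
      isClosed_le (c.continuous_eval_form y) ?_)
  simp_rw [aeval_form]
  fun_prop

/-- The exclusion flow in eigencoordinates. -/
noncomputable def flow (t : ℝ) (x : Fin m → ℝ) : Fin m → ℝ :=
  fun i => Real.exp (-(c.rate i * t)) * x i

/-- The normalized Euler step of the exclusion flow. -/
noncomputable def eulerStep (s : ℝ) (x : Fin m → ℝ) : Fin m → ℝ :=
  fun i => (1 + s * (exclusionRate n k - c.rate i)) / (1 + s * exclusionRate n k) * x i

theorem eulerStep_mem [NeZero n] {s : ℝ} (hs : 0 ≤ s) {x : Fin m → ℝ} (hx : x ∈ c.stableSet) :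
    c.eulerStep s x ∈ c.stableSet := by
  have hx : IsStableForm (k + 1) (c.form x) := hx
  have hr : 0 < 1 + s * exclusionRate n k :=
    add_pos_of_pos_of_nonneg one_pos (mul_nonneg hs (exclusionRate_nonneg k))
  have hform : c.form (c.eulerStep s x) = (1 + s * exclusionRate n k)⁻¹ •
      (c.form x + s • exclusionOp k (c.form x)) := by
    simp only [form, map_add, map_sum, map_smul, c.op_center, c.op_vec, eulerStep, smul_add,
      Finset.smul_sum, smul_smul]
    rw [add_add_add_comm, ← Finset.sum_add_distrib, ← add_smul]
    congr 1
    · symm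
      convert one_smul ℝ c.center using 2
      field_simp
    · refine Finset.sum_congr rfl fun i _ => ?_
      rw [← add_smul]
      congr 1
      field_simp
  have hst := hx.isRealStable_add_raiseOp (D := k + 1) (Nat.le_succ k) hs
  rw [← exclusionOp_apply] at hst
  show IsStableForm (k + 1) _
  refine ⟨c.form_isHomogeneous _, fun z hz h0 => ?_, fun α => ?_⟩
  · rw [hform, map_smul, smul_eq_zero] at h0
    exact hst z hz (h0.resolve_left (inv_pos.2 hr).ne')
  · rw [hform, coeff_smul, coeff_add, coeff_smul]
    exact mul_nonneg (inv_pos.2 hr).le (add_nonneg (hx.coeff_nonneg α)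
      (mul_nonneg hs (coeff_exclusionOp_nonneg hx.homogeneous hx.coeff_nonneg α)))

/-- The flow is the limit of `N` normalized Euler steps of length `t / N`, each of which preserves
the closed set of stable forms. -/
theorem flow_mem [NeZero n] {t : ℝ} (ht : 0 ≤ t) {x : Fin m → ℝ} (hx : x ∈ c.stableSet) :
    c.flow t x ∈ c.stableSet := by
  have hmem : ∀ N : ℕ, (c.eulerStep (t / N))^[N] x ∈ c.stableSet := by
    intro N
    have : ∀ j : ℕ, (c.eulerStep (t / N))^[j] x ∈ c.stableSet := by
      intro j
      induction j with
      | zero => exact hx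
      | succ j ih =>
        rw [Function.iterate_succ_apply']
        exact c.eulerStep_mem (by positivity) ih
    exact this N
  have hiter : ∀ (s : ℝ) (N : ℕ) (i : Fin m), (c.eulerStep s)^[N] x i =
      (1 + s * (exclusionRate n k - c.rate i)) ^ N / (1 + s * exclusionRate n k) ^ N * x i := by
    intro s N i
    induction N with
    | zero => simp
    | succ N ih =>
      rw [Function.iterate_succ_apply', eulerStep, ih, pow_succ, pow_succ, mul_div_mul_comm]
      ring
  refine c.isClosed_stableSet.mem_of_tendsto (b := atTop)
    (f := fun N : ℕ => (c.eulerStep (t / N))^[N] x) ?_ (Eventually.of_forall hmem)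
  rw [tendsto_pi_nhds]
  intro i
  simp_rw [hiter]
  have h1 := Real.tendsto_one_add_div_pow_exp (t * (exclusionRate n k - c.rate i))
  have h2 := Real.tendsto_one_add_div_pow_exp (t * exclusionRate n k)
  have h3 := (h1.div h2 (Real.exp_pos _).ne').mul_const (x i)
  rw [← Real.exp_sub] at h3
  have h4 : t * (exclusionRate n k - c.rate i) - t * exclusionRate n k = -(c.rate i * t) := by ring
  rw [h4] at h3
  refine h3.congr fun N => ?_
  simp only [Pi.div_apply]
  rw [mul_div_right_comm, mul_div_right_comm]

/-- The flow solves `f' = A f - exclusionRate n k • f`. It is tested on functionals so as to apply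
both to coefficients and to point values of iterated derivatives. -/
theorem hasDerivAt_map_form_flow (l : MvPolynomial (Fin n) ℝ →ₗ[ℝ] ℝ) (x : Fin m → ℝ) (t : ℝ) :
    HasDerivAt (fun u => l (c.form (c.flow u x)))
      (l (exclusionOp k (c.form (c.flow t x))) - exclusionRate n k * l (c.form (c.flow t x)))
      t := by
  have h : ∀ i, HasDerivAt (fun u => Real.exp (-(c.rate i * u)) * x i * l (c.vec i))
      (-c.rate i * (Real.exp (-(c.rate i * t)) * x i * l (c.vec i))) t := by
    intro i
    have h1 : HasDerivAt (fun u => -(c.rate i * u)) (-c.rate i) t := by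
      simpa using! ((hasDerivAt_id t).const_mul (c.rate i)).neg
    exact ((h1.exp.mul_const (x i)).mul_const (l (c.vec i))).congr_deriv (by ring)
  have h2 := (HasDerivAt.fun_sum fun i (_ : i ∈ Finset.univ) => h i).const_add (l c.center)
  have hfun : (fun u => l (c.form (c.flow u x))) = fun u =>
      l c.center + ∑ i, Real.exp (-(c.rate i * u)) * x i * l (c.vec i) :=
    funext fun u => c.map_form l _
  rw [hfun]
  refine h2.congr_deriv ?_
  simp only [form, flow, map_add, map_sum, map_smul, c.op_center, c.op_vec, smul_eq_mul, mul_add,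
    Finset.mul_sum]
  rw [add_sub_add_left_eq_sub, ← Finset.sum_sub_distrib]
  exact Finset.sum_congr rfl fun i _ => by ring

theorem hasPosCoeffs_flow [NeZero n] {t : ℝ} (ht : 0 < t) {x : Fin m → ℝ} (hx : x ∈ c.stableSet) :
    HasPosCoeffs (k + 1) (c.form (c.flow t x)) := by
  have hst : IsStableForm (k + 1) (c.form (c.flow t x)) := c.flow_mem ht.le hx
  refine hasPosCoeffs_of_coeff_raiseOp hst.homogeneous hst.coeff_nonneg (c.form_ne_zero _)
    fun α hα => ?_
  -- Since `t > 0`, the coefficient is nonnegative on both sides of `t`; its derivative there, which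
  -- is the coefficient of `A f`, must vanish.
  have hmin : IsLocalMin (fun u => lcoeff ℝ α (c.form (c.flow u x))) t := by
    filter_upwards [lt_mem_nhds ht] with u hu
    have hu : IsStableForm (k + 1) (c.form (c.flow u x)) := c.flow_mem hu.le hx
    simp only [lcoeff_apply, hα]
    exact hu.coeff_nonneg α
  have := hmin.hasDerivAt_eq_zero (c.hasDerivAt_map_form_flow (lcoeff ℝ α) x t)
  simp only [lcoeff_apply, hα, mul_zero, sub_zero] at this
  exact this.le

/-- After a positive time all real zeros are simple in the direction `(1, …, 1)`. -/
theorem eval_diagDeriv_flow_ne_zero [NeZero n] {t : ℝ} (ht : 0 < t) {x : Fin m → ℝ}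
    (hx : x ∈ c.stableSet) {y : Fin n → ℝ} (hy : y ≠ 0) (h0 : eval y (c.form (c.flow t x)) = 0) :
    eval y (diagDeriv (c.form (c.flow t x))) ≠ 0 := by
  set g := c.form (c.flow t x) with hg
  have hst : IsStableForm (k + 1) g := c.flow_mem ht.le hx
  have hpos : HasPosCoeffs (k + 1) g := c.hasPosCoeffs_flow ht hx
  -- The last derivative `∂^(k+1) g` is a positive constant. The least such `j` is to be shown equal
  -- to `1`.
  have hex : ∃ j, eval y ((⇑diagDeriv)^[j] g) ≠ 0 := by
    refine ⟨k + 1, ?_⟩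
    have h1 : HasPosCoeffs 0 ((⇑diagDeriv)^[k + 1] g) :=
      HasPosCoeffs.hasPosCoeffs_iterate (d := 0) (k + 1) (by rwa [zero_add])
    have h2 := iterate_diagDeriv_isHomogeneous hst.homogeneous (k + 1)
    rw [Nat.sub_self, ← totalDegree_zero_iff_isHomogeneous, totalDegree_eq_zero_iff_eq_C] at h2
    rw [h2, eval_C]
    exact (h1 0 (by simp)).ne'
  classical
  have hspec := Nat.find_spec hex
  have hmin := fun j (hj : j < Nat.find hex) => not_not.1 (Nat.find_min hex hj)
  set j := Nat.find hex with hj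
  have hjk : j ≤ k + 1 := by
    by_contra hlt
    have h1 := hmin (k + 1) (by omega)
    have h2 : HasPosCoeffs 0 ((⇑diagDeriv)^[k + 1] g) :=
      HasPosCoeffs.hasPosCoeffs_iterate (d := 0) (k + 1) (by rwa [zero_add])
    have h3 := iterate_diagDeriv_isHomogeneous hst.homogeneous (k + 1)
    rw [Nat.sub_self, ← totalDegree_zero_iff_isHomogeneous, totalDegree_eq_zero_iff_eq_C] at h3
    rw [h3, eval_C] at h1
    exact (h2 0 (by simp)).ne' h1
  rcases Nat.lt_or_ge j 2 with hj2 | hj2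
  · have : j ≠ 0 := by
      intro hj0
      rw [hj0] at hspec
      exact hspec h0
    have hj1 : j = 1 := by omega
    rwa [hj1] at hspec
  exfalso
  obtain ⟨i, hi⟩ : ∃ i, j = i + 2 := ⟨j - 2, by omega⟩
  obtain ⟨d, hd⟩ : ∃ d, k + 1 = d + 2 + i := ⟨k - 1 - i, by omega⟩
  have hiter : ∀ f : MvPolynomial (Fin n) ℝ, diagDeriv ((⇑diagDeriv)^[i] f) =
      (⇑diagDeriv)^[i + 1] f := fun f => (Function.iterate_succ_apply' _ _ _).symm
  have hiter2 : ∀ f : MvPolynomial (Fin n) ℝ, diagDeriv ((⇑diagDeriv)^[i + 1] f) =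
      (⇑diagDeriv)^[i + 2] f := fun f => (Function.iterate_succ_apply' _ _ _).symm
  have hG0 : eval y ((⇑diagDeriv)^[i] g) = 0 := hmin i (by omega)
  have hH0 : eval y ((⇑diagDeriv)^[i + 1] g) = 0 := hmin (i + 1) (by omega)
  have hH1 : eval y (diagDeriv ((⇑diagDeriv)^[i + 1] g)) ≠ 0 := by
    rw [hiter2, ← hi]
    exact hspec
  have hHst : IsStableForm (d + 1) ((⇑diagDeriv)^[i + 1] g) :=
    IsStableForm.isStableForm_iterate (i + 1) (by
      have : d + 1 + (i + 1) = k + 1 := by omega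
      rwa [this])
  have hHpos : HasPosCoeffs (d + 1) ((⇑diagDeriv)^[i + 1] g) :=
    HasPosCoeffs.hasPosCoeffs_iterate (i + 1) (by
      have : d + 1 + (i + 1) = k + 1 := by omega
      rwa [this])
  have hsq : (fun l => y l ^ 2) ≠ 0 := fun h => hy (funext fun l => by
    simpa using congrFun h l)
  have hdir := hHst.stable.dirDeriv_mul_dirDeriv_pos hHst.homogeneous
    (u := fun l => y l ^ 2) (v := fun _ => 1) (fun l => sq_nonneg _) (fun _ => zero_le_one)
    (hHpos.eval_pos hHst.homogeneous (fun l => sq_nonneg _) hsq).ne' hH0 hH1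
  let ev : ℕ → MvPolynomial (Fin n) ℝ →ₗ[ℝ] ℝ := fun j =>
    (aeval y : MvPolynomial (Fin n) ℝ →ₐ[ℝ] ℝ).toLinearMap.comp (diagDeriv ^ j)
  have hev : ∀ j f, ev j f = eval y ((⇑diagDeriv)^[j] f) := by
    intro j f
    simp [ev, Module.End.pow_apply, aeval_eq_eval]
  have hder := fun j => c.hasDerivAt_map_form_flow (ev j) x t
  -- For `G = ∂^i g` and `H = ∂G`, Laguerre's inequality keeps `H² - G ∂H` at `y` nonnegative along
  -- the flow. It is zero at time `t`, so its time derivative there is zero.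
  have hθ := ((hder (i + 1)).pow 2).sub ((hder i).mul (hder (i + 2)))
  have hlocal : IsLocalMin ((fun u => ev (i + 1) (c.form (c.flow u x))) ^ 2 -
      (fun u => ev i (c.form (c.flow u x))) * fun u => ev (i + 2) (c.form (c.flow u x))) t := by
    filter_upwards [lt_mem_nhds ht] with u hu
    have hu : IsStableForm (k + 1) (c.form (c.flow u x)) := c.flow_mem hu.le hx
    have hF : IsStableForm (d + 2) ((⇑diagDeriv)^[i] (c.form (c.flow u x))) :=
      IsStableForm.isStableForm_iterate i (by rwa [← hd])
    have hL := hF.stable.mul_dirDeriv_dirDeriv_le (v := fun _ => 1) (fun _ => zero_le_one) y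
    rw [hiter, hiter2] at hL
    simp only [Pi.sub_apply, Pi.pow_apply, Pi.mul_apply, hev, ← hg, hG0, hH0]
    linarith
  have hzero := hlocal.hasDerivAt_eq_zero hθ
  obtain ⟨κ, hκ⟩ := exists_iterate_diagDeriv_raiseOp (k + 1) hst.homogeneous i
  have hφ : eval y ((⇑diagDeriv)^[i] (exclusionOp k g)) =
      -eval y (dirDeriv (fun l => y l ^ 2) ((⇑diagDeriv)^[i + 1] g)) := by
    rw [exclusionOp_apply, hκ, map_add, smul_eval, hG0, mul_zero, add_zero,
      eval_raiseOp_of_eval_eq_zero _ hH0]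
  simp only [hev, ← hg, hG0, hH0, hφ, ← hiter2] at hzero
  -- At time `t` that derivative is `-G' ∂H`, and `G'` is minus the derivative of `H` in the
  -- direction `y²`. The product is positive by the sign rule for simple zeros, a contradiction.
  refine hdir.ne' ?_
  simp only [mul_zero, zero_mul, sub_zero, add_zero, Nat.add_one_sub_one, pow_one, zero_sub] at hzero
  linarith

end EigenChart

end ExclusionFlow

end

section

open MvPolynomial Filter Topology

/-! ### The flow moves stable forms into the interior -/

section Interior

variable {n : ℕ}

/-- Divided differences of a polynomial along a line depend continuously on all parameters. -/
theorem exists_continuous_dividedDifference (f : MvPolynomial (Fin n) ℝ) :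
    ∃ q : (Fin n → ℂ) × (Fin n → ℂ) × ℂ → ℂ, Continuous q ∧
      (∀ z w s, aeval (fun i => z i + s * w i) f = aeval z f + s * q (z, w, s)) ∧
      ∀ z w, q (z, w, 0) = ∑ i, w i * aeval z (pderiv i f) := by
  have hc : ∀ g : MvPolynomial (Fin n) ℝ,
      Continuous fun p : (Fin n → ℂ) × (Fin n → ℂ) × ℂ => aeval p.1 g :=
    fun g => (continuous_aeval_complex g).comp continuous_fst
  induction f using MvPolynomial.induction_on with
  | C a => exact ⟨fun _ => 0, continuous_const, by simp, by simp⟩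
  | add f g hf hg =>
    obtain ⟨q, hq, hq1, hq2⟩ := hf
    obtain ⟨r, hr, hr1, hr2⟩ := hg
    refine ⟨fun p => q p + r p, hq.add hr, fun z w s => ?_, fun z w => ?_⟩
    · rw [map_add, map_add, hq1, hr1]; ring
    · simp [hq2, hr2, mul_add, Finset.sum_add_distrib]
  | mul_X f i hf =>
    obtain ⟨q, hq, hq1, hq2⟩ := hf
    refine ⟨fun p => q p * (p.1 i + p.2.2 * p.2.1 i) + aeval p.1 f * p.2.1 i, ?_,
      fun z w s => ?_, fun z w => ?_⟩
    · have := hc f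
      fun_prop
    · rw [map_mul, map_mul, hq1, aeval_X, aeval_X]; ring
    · have hX : ∀ j, aeval z (pderiv j (X i : MvPolynomial (Fin n) ℝ)) =
          if i = j then (1 : ℂ) else 0 := by
        intro j
        rw [pderiv_X, Pi.single_apply]
        split_ifs <;> simp_all
      simp only [hq2, zero_mul, add_zero, Derivation.leibniz, smul_eq_mul, map_add, map_mul,
        aeval_X, hX, mul_add, Finset.sum_add_distrib, mul_ite, mul_one, mul_zero,
        Finset.sum_ite_eq, Finset.mem_univ, if_true, Finset.sum_mul]
      rw [add_comm, mul_comm (aeval z f)]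
      congr 1
      exact Finset.sum_congr rfl fun j _ => by ring

theorem aeval_ofReal_dirDeriv (f : MvPolynomial (Fin n) ℝ) (x v : Fin n → ℝ) :
    ∑ i, (v i : ℂ) * aeval (fun j => (x j : ℂ)) (pderiv i f) =
      ((eval x (dirDeriv v f) : ℝ) : ℂ) := by
  rw [dirDeriv_apply, map_sum, Complex.ofReal_sum]
  refine Finset.sum_congr rfl fun i _ => ?_
  rw [smul_eval, aeval_ofReal, Complex.ofReal_mul]

theorem aeval_smul_of_isHomogeneous {f : MvPolynomial (Fin n) ℝ} {d : ℕ} (hf : f.IsHomogeneous d)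
    (r : ℂ) (z : Fin n → ℂ) : aeval (fun i => r * z i) f = r ^ d * aeval z f := by
  rw [aeval_def, eval₂_eq', aeval_def, eval₂_eq', Finset.mul_sum]
  refine Finset.sum_congr rfl fun α hα => ?_
  have : α.degree = d := by
    by_contra h
    exact (mem_support_iff.1 hα) (hf.coeff_eq_zero h)
  simp_rw [mul_pow, Finset.prod_mul_distrib, Finset.prod_pow_eq_pow_sum]
  rw [← Finsupp.degree_eq_sum, this]
  ring

/-- A polynomial that is not real stable has a normalized zero in the upper half-space. -/
theorem exists_normalized_zero [NeZero n] {f : MvPolynomial (Fin n) ℝ} {d : ℕ}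
    (hf : f.IsHomogeneous d) (h : ¬ IsRealStable f) :
    ∃ p : (Fin n → ℂ) × (Fin n → ℝ), p ∈ Metric.sphere (0 : Fin n → ℂ) 1 ×ˢ
      Metric.sphere (0 : Fin n → ℝ) 1 ∧ ∃ τ : ℝ, 0 < τ ∧ (∀ j, (p.1 j).im = τ * p.2 j) ∧
        (∀ j, 0 ≤ p.2 j) ∧ aeval p.1 f = 0 := by
  unfold IsRealStable at h
  push Not at h
  obtain ⟨z, hz, h0⟩ := h
  have hz0 : z ≠ 0 := by
    rintro rfl
    simpa using hz 0
  have hzn : 0 < ‖z‖ := norm_pos_iff.2 hz0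
  -- The zero and the direction of its imaginary part are normalized separately, so a limiting
  -- direction survives even if the zeros become real.
  let y : Fin n → ℝ := fun j => (‖z‖⁻¹ • z) j |>.im
  have hypos : ∀ j, 0 < y j := fun j => by
    simpa [y] using mul_pos (inv_pos.2 hzn) (hz j)
  have hy0 : y ≠ 0 := fun h => (hypos 0).ne' (congrFun h 0)
  have hyn : 0 < ‖y‖ := norm_pos_iff.2 hy0
  refine ⟨(‖z‖⁻¹ • z, ‖y‖⁻¹ • y), ⟨?_, ?_⟩, ‖y‖, hyn, fun j => ?_, fun j => ?_, ?_⟩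
  · rw [mem_sphere_zero_iff_norm, norm_smul, norm_inv, norm_norm, inv_mul_cancel₀ hzn.ne']
  · rw [mem_sphere_zero_iff_norm, norm_smul, norm_inv, norm_norm, inv_mul_cancel₀ hyn.ne']
  · simp only [Pi.smul_apply, smul_eq_mul (a := ‖y‖⁻¹)]
    rw [mul_inv_cancel_left₀ hyn.ne']
    rfl
  · exact mul_nonneg (inv_pos.2 hyn).le (hypos j).le
  · have := aeval_smul_of_isHomogeneous hf ((‖z‖⁻¹ : ℝ) : ℂ) z
    rw [h0, mul_zero] at this
    convert this using 2
    ext j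
    simp

namespace EigenChart

variable {k m : ℕ} (c : EigenChart n k m)

theorem continuous_aeval_form :
    Continuous fun p : (Fin m → ℝ) × (Fin n → ℂ) => aeval p.2 (c.form p.1) := by
  simp_rw [aeval_form]
  have h : ∀ g : MvPolynomial (Fin n) ℝ,
      Continuous fun p : (Fin m → ℝ) × (Fin n → ℂ) => aeval p.2 g :=
    fun g => (continuous_aeval_complex g).comp continuous_snd
  refine (h _).add (continuous_finsetSum _ fun i _ => Continuous.mul ?_ (h _))
  fun_prop

theorem exists_continuous_dividedDifference_form :
    ∃ q : (Fin m → ℝ) × (Fin n → ℂ) × (Fin n → ℂ) × ℂ → ℂ, Continuous q ∧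
      (∀ x z w s, aeval (fun i => z i + s * w i) (c.form x) =
        aeval z (c.form x) + s * q (x, z, w, s)) ∧
      ∀ x z w, q (x, z, w, 0) = ∑ i, w i * aeval z (pderiv i (c.form x)) := by
  obtain ⟨q0, hq0, h01, h02⟩ := exists_continuous_dividedDifference c.center
  choose q hq h1 h2 using fun i => exists_continuous_dividedDifference (c.vec i)
  refine ⟨fun p => q0 p.2 + ∑ i, (p.1 i : ℂ) * q i p.2, ?_, fun x z w s => ?_, fun x z w => ?_⟩
  · fun_prop
  · rw [aeval_form, aeval_form, h01]
    simp_rw [h1, mul_add, Finset.sum_add_distrib, Finset.mul_sum]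
    have : ∀ i, (x i : ℂ) * (s * q i (z, w, s)) = s * (x i * q i (z, w, s)) := fun i => by ring
    simp_rw [this]
    ring
  · simp only [h02, h2]
    have : ∀ i, aeval z (pderiv i (c.form x)) = aeval z (pderiv i c.center) +
        ∑ l, (x l : ℂ) * aeval z (pderiv i (c.vec l)) := by
      intro i
      simp [form]
    simp_rw [this, mul_add, Finset.sum_add_distrib, Finset.mul_sum]
    congr 1
    rw [Finset.sum_comm]
    exact Finset.sum_congr rfl fun i _ => Finset.sum_congr rfl fun l _ => by ring

/-- Coefficients stay positive nearby, so failure means that unstable forms converge to `c.flow t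
x`. Their normalized zeros accumulate at a zero of the limit. A nonreal limit contradicts the lower
bound on the closed half-space, and a real one contradicts simplicity of real zeros. -/
theorem flow_mem_interior [NeZero n] {t : ℝ} (ht : 0 < t) {x : Fin m → ℝ}
    (hx : x ∈ c.stableSet) : c.flow t x ∈ interior c.stableSet := by
  rw [mem_interior_iff_mem_nhds]
  by_contra hnot
  set x₀ := c.flow t x with hx₀
  have hst : IsStableForm (k + 1) (c.form x₀) := c.flow_mem ht.le hx
  have hpos : HasPosCoeffs (k + 1) (c.form x₀) := c.hasPosCoeffs_flow ht hx
  have hev : ∀ᶠ y in 𝓝 x₀, ∀ α ∈ exponents n (k + 1), 0 < coeff α (c.form y) := by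
    rw [Finset.eventually_all]
    intro α hα
    exact (c.continuous_coeff_form α).continuousAt.eventually_const_lt
      (hpos α (mem_exponents.1 hα))
  have hfreq : ∃ᶠ y in 𝓝 x₀, ¬ IsRealStable (c.form y) := by
    intro h
    refine hnot ?_
    filter_upwards [h, hev] with y hy hy'
    refine ⟨c.form_isHomogeneous y, not_not.1 hy, fun α => ?_⟩
    by_cases hα : α.degree = k + 1
    · exact (hy' α (mem_exponents.2 hα)).le
    · rw [(c.form_isHomogeneous y).coeff_eq_zero hα]
  obtain ⟨u, hu, hbad⟩ := exists_seq_forall_of_frequently hfreq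
  choose p hpS τ hτ him hnn hz using fun N => exists_normalized_zero
    (c.form_isHomogeneous (u N)) (hbad N)
  obtain ⟨⟨z, v⟩, ⟨hzS, hvS⟩, φ, hφ, hlim⟩ :=
    ((isCompact_sphere (0 : Fin n → ℂ) 1).prod (isCompact_sphere (0 : Fin n → ℝ) 1)).tendsto_subseq
      hpS
  rw [mem_sphere_zero_iff_norm] at hzS hvS
  have hu' : Tendsto (u ∘ φ) atTop (𝓝 x₀) := hu.comp hφ.tendsto_atTop
  have hz' : Tendsto (fun N => (p (φ N)).1) atTop (𝓝 z) := (continuous_fst.tendsto _).comp hlim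
  have hv' : Tendsto (fun N => (p (φ N)).2) atTop (𝓝 v) := (continuous_snd.tendsto _).comp hlim
  have hvnn : ∀ j, 0 ≤ v j := fun j =>
    ge_of_tendsto (((continuous_apply j).tendsto v).comp hv')
      (Eventually.of_forall fun N => hnn (φ N) j)
  have hv0 : v ≠ 0 := fun h => by simp [h] at hvS
  have hzero : aeval z (c.form x₀) = 0 := by
    have h1 := (c.continuous_aeval_form.tendsto (x₀, z)).comp (hu'.prodMk_nhds hz')
    refine tendsto_nhds_unique h1 ?_
    refine tendsto_const_nhds.congr fun N => ?_
    simp [hz]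
  have hτnorm : ∀ N, τ N = ‖fun j => ((p N).1 j).im‖ := by
    intro N
    have h1 : (fun j => ((p N).1 j).im) = τ N • (p N).2 := funext fun j => him N j
    have h2 : ‖(p N).2‖ = 1 := mem_sphere_zero_iff_norm.1 (hpS N).2
    rw [h1, norm_smul, h2, mul_one, Real.norm_of_nonneg (hτ N).le]
  have hcim : Continuous fun z : Fin n → ℂ => fun j => (z j).im := by fun_prop
  have hτ' : Tendsto (fun N => τ (φ N)) atTop (𝓝 ‖fun j => (z j).im‖) := by
    simp_rw [hτnorm]
    exact ((hcim.norm).tendsto z).comp hz'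
  set τ₀ := ‖fun j => (z j).im‖ with hτ₀
  have hzim : ∀ j, (z j).im = τ₀ * v j := fun j =>
    tendsto_nhds_unique ((((continuous_apply j).comp hcim).tendsto z).comp hz')
      ((hτ'.mul (((continuous_apply j).tendsto v).comp hv')).congr fun N =>
        (him (φ N) j).symm)
  have hτ₀nn : 0 ≤ τ₀ := norm_nonneg _
  rcases hτ₀nn.eq_or_lt with h0 | h0
  · obtain ⟨q, hq, hq1, hq2⟩ := c.exists_continuous_dividedDifference_form
    -- Expanding the zero at `a + iτ v` about its real part `a`, where the form is real, the
    -- imaginary part is `τ` times the real part of `q`. In the limit this says that the derivative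
    -- in the direction `v` vanishes.
    have hreal : ∀ N, (q (u N, (fun j => (((p N).1 j).re : ℂ)), (fun j => ((p N).2 j : ℂ)),
        (τ N : ℂ) * Complex.I)).re = 0 := by
      intro N
      have h1 := hq1 (u N) (fun j => (((p N).1 j).re : ℂ)) (fun j => ((p N).2 j : ℂ))
        ((τ N : ℂ) * Complex.I)
      have h2 : (fun j => (((p N).1 j).re : ℂ) + (τ N : ℂ) * Complex.I * ((p N).2 j : ℂ)) =
          (p N).1 := by
        ext j
        rw [mul_right_comm, ← Complex.ofReal_mul, ← him, Complex.re_add_im]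
      rw [h2, hz, aeval_ofReal (c.form (u N))] at h1
      have h3 := congrArg Complex.im h1
      rw [Complex.zero_im, Complex.add_im, Complex.ofReal_im, zero_add, mul_assoc,
        Complex.im_ofReal_mul, Complex.I_mul_im] at h3
      exact (mul_eq_zero.1 h3.symm).resolve_left (hτ N).ne'
    set a : Fin n → ℝ := fun j => (z j).re with ha
    have hza : z = fun j => (a j : ℂ) := by
      ext j
      apply Complex.ext
      · simp [ha]
      · simp [hzim, ← h0]
    have hcre : Continuous fun z : Fin n → ℂ => fun j => ((z j).re : ℂ) := by fun_prop
    have hcof : Continuous fun v : Fin n → ℝ => fun j => (v j : ℂ) := by fun_prop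
    have hlim2 := ((Complex.continuous_re.comp hq).tendsto _).comp
      (hu'.prodMk_nhds (((hcre.tendsto z).comp hz').prodMk_nhds
        (((hcof.tendsto v).comp hv').prodMk_nhds
          (((Complex.continuous_ofReal.tendsto τ₀).comp hτ').mul_const Complex.I))))
    have h4 := tendsto_nhds_unique hlim2
      (tendsto_const_nhds.congr fun N => (hreal (φ N)).symm)
    rw [← h0, Complex.ofReal_zero, zero_mul, Function.comp_apply, hq2,
      aeval_ofReal_dirDeriv, Complex.ofReal_re] at h4
    rw [hza, aeval_ofReal, Complex.ofReal_eq_zero] at hzero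
    have ha0 : a ≠ 0 := by
      intro h
      rw [hza, h] at hzS
      have : (fun j : Fin n => (((0 : Fin n → ℝ) j : ℝ) : ℂ)) = 0 := by ext j; simp
      rw [this, norm_zero] at hzS
      exact zero_ne_one hzS
    have h5 := c.eval_diagDeriv_flow_ne_zero ht hx ha0 hzero
    have h6 := hst.stable.dirDeriv_mul_dirDeriv_pos hst.homogeneous hvnn (fun _ => zero_le_one)
      (hpos.eval_pos hst.homogeneous hvnn hv0).ne' hzero h5
    have h7 : eval a (dirDeriv v (c.form x₀)) = 0 := h4
    rw [h7, zero_mul] at h6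
    exact lt_irrefl _ h6
  · have h1 := hst.stable.eval_le_norm_of_nonneg hst.homogeneous (fun j => (z j).re)
      (y := fun j => (z j).im) fun j => by
        rw [hzim]; exact mul_nonneg h0.le (hvnn j)
    simp_rw [Complex.re_add_im] at h1
    rw [hzero, norm_zero] at h1
    refine absurd (hpos.eval_pos hst.homogeneous (y := fun j => (z j).im) (fun j => by
        rw [hzim]; exact mul_nonneg h0.le (hvnn j)) fun h => ?_) (not_lt.2 h1)
    rw [h, norm_zero] at hτ₀
    exact h0.ne' hτ₀

end EigenChart

end Interior

end

section

open MvPolynomial Filter Topology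

/-! ### The space of normalized stable forms -/

section Assembly

variable {n : ℕ}

/-- The forms of degree `d` that vanish at `(1, …, 1)`. -/
noncomputable def vanishingForms (n d : ℕ) : Submodule ℝ (MvPolynomial (Fin n) ℝ) :=
  homogeneousSubmodule (Fin n) ℝ d ⊓
    LinearMap.ker (aeval fun _ => (1 : ℝ) : MvPolynomial (Fin n) ℝ →ₐ[ℝ] ℝ).toLinearMap

theorem mem_vanishingForms {d : ℕ} {f : MvPolynomial (Fin n) ℝ} :
    f ∈ vanishingForms n d ↔ f.IsHomogeneous d ∧ eval (fun _ => (1 : ℝ)) f = 0 := by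
  simp [vanishingForms, aeval_eq_eval]

instance (n d : ℕ) : FiniteDimensional ℝ (vanishingForms n d) :=
  have : FiniteDimensional ℝ (homogeneousSubmodule (Fin n) ℝ d) :=
    Module.Finite.iff_fg.2 (homogeneousSubmodule_fg _ _ d)
  Submodule.finiteDimensional_of_le inf_le_left

/-- The normalized forms make up the affine space through the normalized stationary form parallel to
`vanishingForms`. The operator preserves that subspace, so it has an eigenbasis there, and its
eigenvalues lie below `exclusionRate n k`. -/
theorem exists_eigenChart (n k : ℕ) [NeZero n] :
    ∃ (m : ℕ) (c : EigenChart n k m), LinearIndependent ℝ c.vec ∧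
      ∀ f : MvPolynomial (Fin n) ℝ, f.IsHomogeneous (k + 1) → eval (fun _ => (1 : ℝ)) f = 1 →
        ∃ x, c.form x = f := by
  have hmaps : ∀ f ∈ vanishingForms n (k + 1), exclusionOp k f ∈ vanishingForms n (k + 1) := by
    intro f hf
    rw [mem_vanishingForms] at hf ⊢
    exact ⟨exclusionOp_isHomogeneous hf.1, by rw [eval_one_exclusionOp hf.1, hf.2, mul_zero]⟩
  obtain ⟨m, b, μ, hb⟩ := exists_basis_eigenvectors (V := vanishingForms n (k + 1))
    (fun f g => binomForm (k + 1) (k + 1) f.1 g.1)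
    (fun f g h => binomForm_add_left _ _ _ _ _) (fun r f g => binomForm_smul_left _ _ _ _ _)
    (fun f g => binomForm_comm _ _ _ _) (fun f => binomForm_self_nonneg le_rfl _)
    (fun f hf => Subtype.ext
      (eq_zero_of_binomForm_self le_rfl (mem_vanishingForms.1 f.2).1 hf))
    ((exclusionOp k).restrict hmaps) (fun f g => binomForm_exclusionOp k f.1 g.1)
  have hb' : ∀ i, exclusionOp k (b i).1 = μ i • (b i).1 := fun i => congrArg Subtype.val (hb i)
  have hmem := fun i => mem_vanishingForms.1 (b i).2
  have hP := stationaryForm_isHomogeneous n k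
  have hP1 := eval_one_stationaryForm_pos n k
  set r := eval (fun _ => (1 : ℝ)) (stationaryForm n k) with hr
  let c : EigenChart n k m :=
    { center := r⁻¹ • stationaryForm n k
      vec := fun i => (b i).1
      rate := fun i => exclusionRate n k - μ i
      center_hom := by
        rw [smul_eq_C_mul]
        exact hP.C_mul _
      vec_hom := fun i => (hmem i).1
      center_eval := by rw [smul_eval, ← hr, inv_mul_cancel₀ hP1.ne']
      vec_eval := fun i => (hmem i).2
      rate_pos := fun i => by
        by_contra h
        refine b.ne_zero i (Subtype.ext ?_)
        exact eq_zero_of_exclusionOp_eq (hmem i).1 (hmem i).2 (hb' i) (by linarith)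
      op_center := by rw [map_smul, exclusionOp_stationaryForm, smul_comm]
      op_vec := fun i => by rw [hb', sub_sub_cancel] }
  refine ⟨m, c, ?_, fun f hf hf1 => ?_⟩
  · exact b.linearIndependent.map' (vanishingForms n (k + 1)).subtype (Submodule.ker_subtype _)
  · have hv : f - c.center ∈ vanishingForms n (k + 1) := by
      rw [mem_vanishingForms]
      exact ⟨hf.sub c.center_hom, by rw [map_sub, hf1, c.center_eval, sub_self]⟩
    refine ⟨b.repr ⟨_, hv⟩, ?_⟩
    have h1 := congrArg Subtype.val (b.sum_repr ⟨_, hv⟩)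
    rw [Submodule.coe_sum] at h1
    have h2 : c.form (b.repr ⟨_, hv⟩) = c.center + (f - c.center) := by
      rw [EigenChart.form]
      congr 1
    rw [h2, add_sub_cancel]

namespace EigenChart

variable {k m : ℕ} (c : EigenChart n k m)

theorem form_injective (hli : LinearIndependent ℝ c.vec) : Function.Injective c.form := by
  intro x y h
  have h1 : ∑ i, (x i - y i) • c.vec i = 0 := by
    simp only [sub_smul, Finset.sum_sub_distrib]
    exact sub_eq_zero.2 (add_left_cancel h)
  ext i
  exact sub_eq_zero.1 (Fintype.linearIndependent_iff.1 hli _ h1 i)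

/-- Nonnegative coefficients with sum `1` lie in `[0, 1]`, and the injective linear passage from
coordinates to coefficients is a closed embedding, so a box of coefficients has compact preimage. -/
theorem isCompact_stableSet (hli : LinearIndependent ℝ c.vec) : IsCompact c.stableSet := by
  let L : (Fin m → ℝ) →ₗ[ℝ] (exponents n (k + 1) → ℝ) :=
    (LinearMap.pi fun α => lcoeff ℝ α.1).comp (Fintype.linearCombination ℝ c.vec)
  have hLa : ∀ x α, L x α = coeff α.1 (∑ i, x i • c.vec i) := fun x α => by
    simp [L, Fintype.linearCombination_apply, coeff_sum]
  have hL : LinearMap.ker L = ⊥ := by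
    rw [LinearMap.ker_eq_bot']
    intro x hx
    have h1 : ∑ i, x i • c.vec i = 0 := by
      ext α
      by_cases hα : α.degree = k + 1
      · have := congrFun hx ⟨α, mem_exponents.2 hα⟩
        rwa [hLa] at this
      · rw [coeff_zero, coeff_sum]
        refine Finset.sum_eq_zero fun i _ => ?_
        rw [coeff_smul, (c.vec_hom i).coeff_eq_zero hα, smul_zero]
    exact funext (Fintype.linearIndependent_iff.1 hli x h1)
  have hemb := LinearMap.isClosedEmbedding_of_injective hL
  have hbox : IsCompact (Set.univ.pi fun α : exponents n (k + 1) =>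
      Set.Icc (0 - coeff α.1 c.center) (1 - coeff α.1 c.center)) :=
    isCompact_univ_pi fun _ => isCompact_Icc
  refine (hemb.isCompact_preimage hbox).of_isClosed_subset c.isClosed_stableSet fun x hx => ?_
  have hx : IsStableForm (k + 1) (c.form x) := hx
  intro α _
  have h1 : L x α = coeff α.1 (c.form x) - coeff α.1 c.center := by
    rw [hLa, form, coeff_add, add_sub_cancel_left]
  have h2 := hx.coeff_nonneg α.1
  have h3 : coeff α.1 (c.form x) ≤ 1 := by
    rw [← c.eval_one_form x, eval_one_eq_sum hx.homogeneous]
    exact Finset.single_le_sum (f := fun α => coeff α (c.form x))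
      (fun β _ => hx.coeff_nonneg β) α.2
  rw [h1]
  constructor <;> linarith

end EigenChart

/-! ### From eigencoordinates to the coefficient topology -/

theorem HomPoly.coeffs_injective {d : ℕ} :
    Function.Injective (HomPoly.coeffs : HomPoly n d → _) := by
  intro f g h
  ext α
  by_cases hα : α.degree = d
  · exact congrFun h ⟨α, hα⟩
  · rw [IsHomogeneous.coeff_eq_zero ((mem_homogeneousSubmodule _ _).1 f.2) hα,
      IsHomogeneous.coeff_eq_zero ((mem_homogeneousSubmodule _ _).1 g.2) hα]

instance (n d : ℕ) : T2Space (HomPoly n d) :=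
  T2Space.of_injective_continuous HomPoly.coeffs_injective continuous_induced_dom

theorem isStableForm_X_pow [NeZero n] (d : ℕ) :
    IsStableForm d (X 0 ^ d : MvPolynomial (Fin n) ℝ) where
  homogeneous := isHomogeneous_X_pow _ _
  stable := fun z hz h => by
    rw [map_pow, aeval_X] at h
    have h0 := hz 0
    rw [eq_zero_of_pow_eq_zero h] at h0
    simp at h0
  coeff_nonneg := fun α => by
    classical
    rw [coeff_X_pow]
    split_ifs <;> norm_num

theorem isStableForm_of_mem {d : ℕ} {f : HomPoly n d} (hf : f ∈ projStableForms n d) :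
    IsStableForm d f.1 :=
  ⟨(mem_homogeneousSubmodule _ _).1 f.2, hf.1.1, hf.1.2⟩

theorem nonempty_homeomorph_stableSet {k m : ℕ} (c : EigenChart n k m)
    (hli : LinearIndependent ℝ c.vec)
    (hsurj : ∀ f : MvPolynomial (Fin n) ℝ, f.IsHomogeneous (k + 1) →
      eval (fun _ => (1 : ℝ)) f = 1 → ∃ x, c.form x = f) :
    Nonempty (c.stableSet ≃ₜ projStableForms n (k + 1)) := by
  let F : c.stableSet → projStableForms n (k + 1) := fun x =>
    ⟨⟨c.form x.1, (mem_homogeneousSubmodule _ _).2 (c.form_isHomogeneous _)⟩,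
      ⟨IsStableForm.stable x.2, IsStableForm.coeff_nonneg x.2⟩, c.eval_one_form _⟩
  have hF : Continuous F := by
    refine Continuous.subtype_mk (continuous_induced_rng.2 (continuous_pi fun α => ?_)) _
    exact (c.continuous_coeff_form α.1).comp continuous_subtype_val
  have hbij : Function.Bijective F := by
    refine ⟨fun x y h => Subtype.ext (c.form_injective hli ?_), fun f => ?_⟩
    · exact congrArg (fun f : projStableForms n (k + 1) => f.1.1) h
    · have hf := isStableForm_of_mem f.2
      obtain ⟨x, hx⟩ := hsurj f.1.1 hf.homogeneous f.2.2
      refine ⟨⟨x, ?_⟩, Subtype.ext (Subtype.ext hx)⟩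
      show IsStableForm (k + 1) (c.form x)
      rwa [hx]
  have := isCompact_iff_compactSpace.1 (c.isCompact_stableSet hli)
  exact ⟨Continuous.homeoOfEquivCompactToT2 (f := Equiv.ofBijective F hbij) hF⟩

theorem projStableForms_zero_eq {f : HomPoly n 0} (hf : f ∈ projStableForms n 0) :
    f.1 = 1 := by
  have h := (mem_homogeneousSubmodule _ _).1 f.2
  rw [← totalDegree_zero_iff_isHomogeneous, totalDegree_eq_zero_iff_eq_C] at h
  have h1 := hf.2
  rw [h, eval_C] at h1
  rw [h, h1, C_1]

end Assembly

end

theorem theorem5 (n d : ℕ) (hn : 1 ≤ n) :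
    ∃ m : ℕ, Nonempty
      (↥(projStableForms n d) ≃ₜ ↥(Metric.closedBall (0 : EuclideanSpace ℝ (Fin m)) 1)) := by
  have : NeZero n := ⟨by omega⟩
  have hX := fun d => isStableForm_X_pow (n := n) d
  rcases d with _ | k
  -- In degree zero the only normalized form is the constant `1`, matching the ball of dimension
  -- zero.
  · refine ⟨0, ⟨?_⟩⟩
    have hsub : Subsingleton (projStableForms n 0) := ⟨fun f g => Subtype.ext (Subtype.ext
      ((projStableForms_zero_eq f.2).trans (projStableForms_zero_eq g.2).symm))⟩
    let f₀ : projStableForms n 0 := ⟨⟨MvPolynomial.X 0 ^ 0, (MvPolynomial.mem_homogeneousSubmodule _ _).2 (hX 0).homogeneous⟩,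
      ⟨(hX 0).stable, (hX 0).coeff_nonneg⟩, by simp⟩
    exact
      { toFun := fun _ => ⟨0, by simp⟩
        invFun := fun _ => f₀
        left_inv := fun _ => Subsingleton.elim _ _
        right_inv := fun _ => Subsingleton.elim _ _
        continuous_toFun := continuous_const
        continuous_invFun := continuous_const }
  · obtain ⟨m, c, hli, hsurj⟩ := exists_eigenChart n k
    obtain ⟨e⟩ := nonempty_homeomorph_stableSet c hli hsurj
    obtain ⟨x, hx⟩ := hsurj (MvPolynomial.X 0 ^ (k + 1)) (hX (k + 1)).homogeneous (by simp)
    have hne : c.stableSet.Nonempty := ⟨x, by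
      show IsStableForm (k + 1) (c.form x)
      rw [hx]
      exact hX (k + 1)⟩
    obtain ⟨e'⟩ := nonempty_homeomorph_closedBall_of_flow c.rate c.rate_pos
      (c.isCompact_stableSet hli) hne fun t ht x hx => c.flow_mem_interior ht hx
    exact ⟨m, ⟨e.symm.trans e'⟩⟩
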